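/- Let $1\le k<n$, $0\le l\le k$ and $\alpha>0$. Let $\Lambda_k=\mathbb Z e_1+\cdots+\mathbb Z e_k\subset\mathbb R^n$ and decompose it as $\Lambda_k=\Lambda_l\oplus\Lambda_{k-l}$ with $\Lambda_l=\mathbb Z e_1+\cdots+\mathbb Z e_l$ and $\Lambda_{k-l}=\mathbb Z e_{l+1}+\cdots+\mathbb Z e_k$. For $\underline v=m_1e_1+\cdots+m_ke_k\in\Lambda_k$ put $\operatorname{sgn}(\underline v)=1$ if $\underline v\in2\Lambda_k$ and $\operatorname{sgn}(\underline v)=-1$ otherwise. Write $x=(\underline x,x_{k+1},\dots,x_n)\in\mathbb R^n$ with $\underline x=(x_1,\dots,x_k)$. Let $\mathcal M_k^-=\mathbb R^n/\!\sim$, with projection $p_-$, where $\sim$ is the equivalence relation generated by $$(\underline x+\underline v,x_{k+1},\dots,x_n)\sim(\underline x,x_{k+1},\dots,x_{n-1},\operatorname{sgn}(\underline v)x_n),\qquad \underline v\in\Lambda_k .$$ Let $Cl_n(\mathbb C)$ be the complexification of $Cl_{n,0}$ or of $Cl_{0,n}$, and let $\mathcal E^{(q)}$ be the pinor bundle on $\mathcal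 M_k^-$ obtained from $\mathbb R^n\times Cl_n(\mathbb C)$ by the identifications $$(\underline x+\underline v,x_{k+1},\dots,x_n,X)\sim(\underline x,x_{k+1},\dots,x_{n-1},\operatorname{sgn}(\underline v)x_n,(-1)^{m_1+\cdots+m_l}X).$$ Let $$E_\alpha(x)=-\frac{i\pi}{2\omega_n\Gamma(n/2)}\Big(\tfrac12 i\alpha\Big)^{\frac n2-1}|x|^{1-\frac n2}H^{(1)}_{\frac n2-1}(i\alpha|x|),$$ where $\omega_n$ is the surface measure of the unit sphere of $\mathbb R^n$ and $H^{(1)}_\nu$ is the first Hankel function. Then the series $$S(x)=\sum_{\underline v\in\Lambda_l\oplus\Lambda_{k-l}}(-1)^{m_1+\cdots+m_l}E_\alpha(\underline x+\underline v,x_{k+1},\dots,x_{n-1},\operatorname{sgn}(\underline v)x_n)$$ converges uniformly on every compact subset of $\mathbb R^n\setminus\Lambda_k$, it descends to a well-defined section $E'_{\alpha,q}=p_-(S)$ of $\mathcal E^{(q)}$ over $\mathcal M_k^-\setminus\{p_-(0)\}$, and $E'_{\alpha,q}$ is a fundamental solution, with pole $p_-(0)$, of the Klein-Gordon operator $\Delta'_\alpha=p_-(\Delta-\alpha^2)$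 for sections of $\mathcal E^{(q)}$. That is: $E'_{\alpha,q}$ is smooth with $\Delta'_\alpha E'_{\alpha,q}=0$ on $\mathcal M_k^-\setminus\{p_-(0)\}$, it is locally integrable, and for every smooth compactly supported section $\varphi$ of $\mathcal E^{(q)}$ $$\int E'_{\alpha,q}\,\Delta'_\alpha\varphi\,dV=\varphi(p_-(0)),$$ where sections are identified with their lifts to $\mathbb R^n$, the integral is taken over the period cell $[0,1)^k\times\mathbb R^{n-k}$ of $\Lambda_k$, and the right-hand side is the value of the lift of $\varphi$ at $0$. -/

import Mathlib

open MeasureTheory Set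
open scoped TensorProduct ContDiff Laplacian

noncomputable section

/-! ### The Klein-Gordon operator and its fundamental solution in Euclidean space -/

/-- The Hankel function of the first kind `H_ν^{(1)}(z)` on the upper half-plane `Im z > 0`, through
Sommerfeld's integral
`H_ν^{(1)}(z) = e^{-νπi/2} / (πi) * ∫_{-∞}^{∞} exp (i z cosh t - ν t) dt`,
which converges absolutely for every `ν` and every `z` with `Im z > 0`
(it is only evaluated at `z = i α |x|` with `α > 0` and `x ≠ 0`). -/
def hankelOne (ν : ℝ) (z : ℂ) : ℂ :=
  Complex.exp (-(ν * Real.pi * Complex.I / 2)) / (Real.pi * Complex.I) *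
    ∫ t : ℝ, Complex.exp (Complex.I * z * Real.cosh t - ν * t)

/-- The surface measure `ω_n` of the unit sphere of `ℝⁿ`. -/
def sphereArea (n : ℕ) : ℝ :=
  ((volume : Measure (EuclideanSpace ℝ (Fin n))).toSphere univ).toReal

/-- `E_α(x) = -(iπ / (2 ω_n Γ(n/2))) (iα/2)^{n/2-1} |x|^{1-n/2} H_{n/2-1}^{(1)}(iα|x|)`. -/
def euclideanKG (n : ℕ) (α : ℝ) (x : EuclideanSpace ℝ (Fin n)) : ℂ :=
  -(Complex.I * Real.pi / (2 * sphereArea n * Real.Gamma ((n : ℝ) / 2))) *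
    (Complex.I * α / 2) ^ ((n : ℂ) / 2 - 1) *
    ((‖x‖ ^ (1 - (n : ℝ) / 2) : ℝ) : ℂ) *
    hankelOne ((n : ℝ) / 2 - 1) (Complex.I * α * ‖x‖)

/-- The Klein-Gordon operator `Δ - α²` on complex valued functions on `ℝⁿ`. -/
def kleinGordon {n : ℕ} (α : ℝ) (u : EuclideanSpace ℝ (Fin n) → ℂ)
    (x : EuclideanSpace ℝ (Fin n)) : ℂ :=
  (Δ u) x - (α : ℂ) ^ 2 * u x

/-! ### The lattice and the Möbius strip

A lattice point `m_1 e_1 + ⋯ + m_k e_k` of `Λ_k` is given by its coordinates `m : Fin k → ℤ`. -/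

/-- The vector `m_1 e_1 + ⋯ + m_k e_k` of `ℝⁿ`. -/
def latticeVec (n : ℕ) {k : ℕ} (m : Fin k → ℤ) : EuclideanSpace ℝ (Fin n) :=
  WithLp.toLp 2 fun i : Fin n => if h : (i : ℕ) < k then (m ⟨i, h⟩ : ℝ) else 0

/-- The lattice `Λ_k` as a subset of `ℝⁿ`. -/
def latticeSet (n k : ℕ) : Set (EuclideanSpace ℝ (Fin n)) :=
  range fun m : Fin k → ℤ => latticeVec n m

open Classical in
/-- `sgn v = 1` for `v ∈ 2 Λ_k` and `sgn v = -1` for `v ∈ Λ_k \ 2 Λ_k`. -/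
def latticeSgn {k : ℕ} (m : Fin k → ℤ) : ℝ :=
  if ∃ m' : Fin k → ℤ, m = 2 • m' then 1 else -1

/-- `(-1)^{m_1 + ⋯ + m_l}`. -/
def latticeChar {k : ℕ} (l : ℕ) (m : Fin k → ℤ) : ℂ :=
  (-1 : ℂ) ^ (∑ i : Fin k, if (i : ℕ) < l then m i else 0 : ℤ)

/-- `(x_1, …, x_n) ↦ (x_1, …, x_{n-1}, ε x_n)`. -/
def scaleLast {n : ℕ} (ε : ℝ) (x : EuclideanSpace ℝ (Fin n)) : EuclideanSpace ℝ (Fin n) :=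
  WithLp.toLp 2 fun i : Fin n => if (i : ℕ) + 1 = n then ε * x i else x i

/-- `(x̲ + v̲, x_{k+1}, …, x_n)` is related to `(x̲, x_{k+1}, …, x_{n-1}, sgn(v̲) x_n)`. -/
def MobiusRel (n k : ℕ) (a b : EuclideanSpace ℝ (Fin n)) : Prop :=
  ∃ (m : Fin k → ℤ) (x : EuclideanSpace ℝ (Fin n)),
    a = x + latticeVec n m ∧ b = scaleLast (latticeSgn m) x

/-- The higher dimensional Möbius strip `𝓜_k^- = ℝⁿ / ∼`, where `∼` is the equivalence relation
generated by `MobiusRel`. -/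
def Mobius (n k : ℕ) : Type := Quot (MobiusRel n k)

/-- The quotient topology. -/
instance instTopologicalSpaceMobius (n k : ℕ) : TopologicalSpace (Mobius n k) :=
  inferInstanceAs (TopologicalSpace (Quot (MobiusRel n k)))

/-- The projection `p_- : ℝⁿ → 𝓜_k^-`. -/
def mobiusProj (n k : ℕ) (x : EuclideanSpace ℝ (Fin n)) : Mobius n k := Quot.mk _ x

/-- The point `p_-(0)`. -/
def mobiusOrigin (n k : ℕ) : Mobius n k := mobiusProj n k 0

/-! ### Clifford algebra and pinor bundles -/

/-- `Cl_n(ℂ)`: the complexification of the real Clifford algebra `Cl_{n,0}` (for `s = 1`, all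
`e_i² = 1`) or `Cl_{0,n}` (for `s = -1`, all `e_i² = -1`). -/
abbrev ComplexClifford (n : ℕ) (s : ℤˣ) : Type :=
  ℂ ⊗[ℝ] CliffordAlgebra (QuadraticMap.weightedSumSquares ℝ fun _ : Fin n => ((s : ℤ) : ℝ))

/-- `(x̲ + v̲, x_{k+1}, …, x_n, X)` is related to
`(x̲, x_{k+1}, …, x_{n-1}, sgn(v̲) x_n, (-1)^{m_1 + ⋯ + m_l} X)`. -/
def PinorRel (n k l : ℕ) (s : ℤˣ) (a b : EuclideanSpace ℝ (Fin n) × ComplexClifford n s) : Prop :=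
  ∃ (m : Fin k → ℤ) (x : EuclideanSpace ℝ (Fin n)) (X : ComplexClifford n s),
    a = (x + latticeVec n m, X) ∧ b = (scaleLast (latticeSgn m) x, latticeChar l m • X)

/-- The total space of the pinor bundle `𝓔^{(q)}` of the decomposition `Λ_k = Λ_l ⊕ Λ_{k-l}`. -/
def PinorBundle (n k l : ℕ) (s : ℤˣ) : Type := Quot (PinorRel n k l s)

/-- The class of `(x, X)` in `𝓔^{(q)}`. -/
def PinorBundle.mk {n k l : ℕ} {s : ℤˣ} (x : EuclideanSpace ℝ (Fin n)) (X : ComplexClifford n s) :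
    PinorBundle n k l s := Quot.mk _ (x, X)

/-- The bundle projection `𝓔^{(q)} → 𝓜_k^-`. -/
def PinorBundle.proj {n k l : ℕ} {s : ℤˣ} : PinorBundle n k l s → Mobius n k :=
  Quot.map Prod.fst (by
    rintro _ _ ⟨m, x, X, rfl, rfl⟩
    exact ⟨m, x, rfl, rfl⟩)

/-- A (set-theoretic) section of `𝓔^{(q)}` over `U ⊆ 𝓜_k^-`. -/
structure PinorSection (n k l : ℕ) (s : ℤˣ) (U : Set (Mobius n k)) where
  toFun : U → PinorBundle n k l s
  proj_toFun : ∀ y : U, (toFun y).proj = y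

/-- `f : ℝⁿ → Cl_n(ℂ)` is a lift of the section `σ`, i.e. `σ = p_-(f)`: for all `x` over `U`,
`σ (p_- x)` is the class of `(x, f x)`. Values of `f` outside of the preimage of `U` are irrelevant. -/
def PinorSection.IsLift {n k l : ℕ} {s : ℤˣ} {U : Set (Mobius n k)} (σ : PinorSection n k l s U)
    (f : EuclideanSpace ℝ (Fin n) → ComplexClifford n s) : Prop :=
  ∀ (x : EuclideanSpace ℝ (Fin n)) (hx : mobiusProj n k x ∈ U),
    σ.toFun ⟨mobiusProj n k x, hx⟩ = PinorBundle.mk x (f x)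

/-! ### Differential calculus for `Cl_n(ℂ)`-valued functions

`Cl_n(ℂ)` is a finite dimensional complex vector space, and `Δ - α²` is a scalar operator; smoothness,
`Δ - α²` and integrals of `Cl_n(ℂ)`-valued functions are taken componentwise, i.e. after
application of an arbitrary linear functional. -/

/-- `f` is `C^∞` on `W`. -/
def CliffordSmoothOn {n : ℕ} {s : ℤˣ} (f : EuclideanSpace ℝ (Fin n) → ComplexClifford n s)
    (W : Set (EuclideanSpace ℝ (Fin n))) : Prop :=
  ∀ c : Module.Dual ℂ (ComplexClifford n s), ContDiffOn ℝ ∞ (fun x => c (f x)) W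

/-- `(Δ - α²) f = h` on `W`. -/
def CliffordKGEqOn {n : ℕ} {s : ℤˣ} (α : ℝ) (f h : EuclideanSpace ℝ (Fin n) → ComplexClifford n s)
    (W : Set (EuclideanSpace ℝ (Fin n))) : Prop :=
  ∀ c : Module.Dual ℂ (ComplexClifford n s), ∀ x ∈ W,
    kleinGordon α (fun y => c (f y)) x = c (h x)

/-- The period cell `[0,1)^k × ℝ^{n-k}` of `Λ_k`. -/
def periodCell (n k : ℕ) : Set (EuclideanSpace ℝ (Fin n)) :=
  {x | ∀ i : Fin n, (i : ℕ) < k → x i ∈ Ico (0 : ℝ) 1}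

/-- `g` is the lift of a smooth global section of `𝓔^{(q)}` with compact support in `𝓜_k^-`. -/
def IsTestLift (k l : ℕ) {n : ℕ} {s : ℤˣ}
    (g : EuclideanSpace ℝ (Fin n) → ComplexClifford n s) : Prop :=
  (∃ φ : PinorSection n k l s univ, φ.IsLift g) ∧ CliffordSmoothOn g univ ∧
    ∃ K : Set (Mobius n k), IsCompact K ∧ ∀ x, mobiusProj n k x ∉ K → g x = 0

/-- The section `σ` of `𝓔^{(q)}` over `𝓜_k^- \ {p_-(0)}` is a fundamental solution, with pole
`p_-(0)`, of the Klein-Gordon operator `Δ'_α = p_-(Δ - α²)` on sections of `𝓔^{(q)}`: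
it is smooth and satisfies `Δ'_α σ = 0` on `𝓜_k^- \ {p_-(0)}`, it is locally integrable on `𝓜_k^-`, and
`Δ'_α σ = δ_{p_-(0)}` as a distribution, that is, `∫ σ · Δ'_α φ dV = φ(p_-(0))` for all
compactly supported smooth sections `φ` of `𝓔^{(q)}`.

All of this is expressed through the lifts `f`, `g`, `h` of `σ`, `φ`, `Δ'_α φ`; the product `f h` is
invariant under `∼` because the signs cancel, and integrals over `𝓜_k^-` are integrals over a
period cell of `Λ_k`. The fibre over `p_-(0)` is identified with `Cl_n(ℂ)` by `X ↦ [0, X]`. -/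
def IsKGFundamentalSolution {n k l : ℕ} {s : ℤˣ} (α : ℝ)
    (σ : PinorSection n k l s {mobiusOrigin n k}ᶜ) : Prop :=
  ∃ f : EuclideanSpace ℝ (Fin n) → ComplexClifford n s,
    σ.IsLift f ∧
    CliffordSmoothOn f (mobiusProj n k ⁻¹' {mobiusOrigin n k}ᶜ) ∧
    CliffordKGEqOn α f 0 (mobiusProj n k ⁻¹' {mobiusOrigin n k}ᶜ) ∧
    (∀ c : Module.Dual ℂ (ComplexClifford n s), LocallyIntegrable (fun x => c (f x)) volume) ∧
    ∀ g h : EuclideanSpace ℝ (Fin n) → ComplexClifford n s,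
      IsTestLift k l g → CliffordKGEqOn α g h univ →
      ∀ c : Module.Dual ℂ (ComplexClifford n s),
        IntegrableOn (fun x => c (f x * h x)) (periodCell n k) volume ∧
        ∫ x in periodCell n k, c (f x * h x) = c (g 0)

/-! ### The series -/

/-- The term `(-1)^{m_1 + ⋯ + m_l} E_α(x̲ + v̲, x_{k+1}, …, x_{n-1}, sgn(v̲) x_n)`. -/
def mobiusTerm (n : ℕ) {k : ℕ} (l : ℕ) (α : ℝ) (m : Fin k → ℤ) (x : EuclideanSpace ℝ (Fin n)) : ℂ :=
  latticeChar l m * euclideanKG n α (scaleLast (latticeSgn m) (x + latticeVec n m))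

/-- The sum of the terms `mobiusTerm` over the lattice `Λ_k = Λ_l ⊕ Λ_{k-l}`. -/
def mobiusSeries (n k l : ℕ) (α : ℝ) (x : EuclideanSpace ℝ (Fin n)) : ℂ :=
  ∑' m : Fin k → ℤ, mobiusTerm n l α m x

end

/-!
The idea is that `-E_α` is the Laplace transform at `α²` of the heat kernel and that the theorem,
apart from the geometry of the quotient, is a statement about this function on `ℝⁿ`.

Sommerfeld's integral for the Hankel function turns, under `s = |x| / (2 α) * exp t`, into
`E_α(x) = -(4 π)^(-n/2) ∫_0^∞ s^(-n/2) exp (-|x|² / (4 s) - α² s) ds` (`euclideanKG_eq`).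
The integrals `∫_0^∞ s^(-a) exp (-b / s - c s) ds` are differentiated in `b` by raising `a`, decay
exponentially in `√b`, and satisfy a three-term recurrence (`besselInt_recurrence`). Hence `E_α` is
smooth off the origin with rapidly decaying derivatives of all orders
(`rapidSmooth_besselRadial`), and `(Δ - α²) E_α = 0` there (`laplacian_besselRadial`). Rapid decay
makes the twisted series over the lattice converge uniformly on compact sets together with all
derivatives, so it may be differentiated term by term (`contDiffOn_periodize`,
`laplacian_periodize`).

That `E_α` is integrable is Fubini's theorem. For `g` with bounded derivatives up to order two, the
Gaussian means `U(s)` of `g`, normalized so that `U(0) = g(0)`, have as derivative the Gaussian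
means of `Δ g`, by Gaussian integration by parts (`BoundedC2.hasDerivAt_gaussMean`); therefore
`-∫ E_α (Δ - α²) g` is the integral over `s > 0` of the derivative of `exp (-α² s) U(s)`, that is,
`-g(0)` (`integral_euclideanKG_mul_kleinGordon`). No decay of `g` is needed, which matters because
lifts of test sections are periodic.

On the quotient, since `E_α` is radial, `E_α(x̲ + v̲, ±x_n) = E_α(x + v̲)`, and the series has the
equivariance of a lift because `(-1)^{m_1 + ⋯ + m_l}` is a character of the lattice
(`mobiusSeries_add_latticeVec`). The sign `sgn` itself is not a character when `k ≥ 2`; what is used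
is only that the generated equivalence relation identifies points that differ by a lattice
translation and possibly a reflection, with the fibre coordinate multiplied by the character of the
translation (`exists_of_eqvGen_pinorRel`). In particular the fibres of the bundle are copies of
`Cl_n(ℂ)`, and lifts of sections are determined by the section. Lifts of test sections are periodic
with respect to `2 Λ_k` and supported near the span of the lattice, hence bounded with all
derivatives (`IsTestLift.boundedC2`). Finally the integral over the period cell of the series
against an equivariant function unfolds to an integral over `ℝⁿ` (`setIntegral_mobiusSeries_mul`),
where the Euclidean identity applies.
-/

open Filter Topology

/-! ### A Bessel-type integral -/

/-- The factor `exp (-b / s)` absorbs the singularity of `s ^ (-a)` at `0`. -/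
theorem exists_rpow_mul_exp_neg_le {a b : ℝ} (ha : 0 ≤ a) (hb : 0 < b) :
    ∃ C : ℝ, 0 ≤ C ∧ ∀ s : ℝ, 0 < s → s ^ (-a) * Real.exp (-(b / s)) ≤ C := by
  rcases ha.eq_or_lt with rfl | ha
  · refine ⟨1, zero_le_one, fun s hs => ?_⟩
    simpa using (div_pos hb hs).le
  -- `t ≤ exp t` at `t = b / (a s)`, raised to the power `a`.
  refine ⟨(a / b) ^ a, by positivity, fun s hs => ?_⟩
  have h1 : b / (a * s) ≤ Real.exp (b / (a * s)) :=
    (by linarith : b / (a * s) ≤ b / (a * s) + 1).trans (Real.add_one_le_exp _)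
  have h2 := Real.rpow_le_rpow (by positivity) h1 ha.le
  rw [← Real.exp_mul] at h2
  have h3 : b / (a * s) * a = b / s := by field_simp
  have h4 : s ^ (-a) = (a / b) ^ a * (b / (a * s)) ^ a := by
    rw [← Real.mul_rpow (by positivity) (by positivity), Real.rpow_neg hs.le,
      ← Real.inv_rpow hs.le]
    congr 1
    field_simp
  rw [h3] at h2
  rw [h4, mul_assoc]
  refine mul_le_of_le_one_right (by positivity) ?_
  calc (b / (a * s)) ^ a * Real.exp (-(b / s))
      ≤ Real.exp (b / s) * Real.exp (-(b / s)) := by gcongr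
    _ = 1 := by rw [← Real.exp_add]; simp

/-- The integral `∫_0^∞ s^(-a) exp (-b / s - c s) ds`, a multiple of
`(b / c) ^ ((1 - a) / 2) K_{a-1} (2 √(b c))` with the modified Bessel function `K`. -/
noncomputable def besselInt (a b c : ℝ) : ℝ :=
  ∫ s in Ioi (0 : ℝ), s ^ (-a) * Real.exp (-(b / s) - c * s)

theorem integrableOn_besselInt {a b c : ℝ} (ha : 0 ≤ a) (hb : 0 < b) (hc : 0 < c) :
    IntegrableOn (fun s : ℝ => s ^ (-a) * Real.exp (-(b / s) - c * s)) (Ioi 0) := by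
  obtain ⟨C, hC0, hC⟩ := exists_rpow_mul_exp_neg_le ha hb
  refine Integrable.mono' ((exp_neg_integrableOn_Ioi 0 hc).const_mul C) ?_ ?_
  · exact (by fun_prop : Measurable fun s : ℝ => s ^ (-a) * Real.exp (-(b / s) - c * s))
      |>.aestronglyMeasurable
  · filter_upwards [ae_restrict_mem measurableSet_Ioi] with s hs
    have hs : 0 < s := hs
    rw [Real.norm_of_nonneg (by positivity), sub_eq_add_neg, Real.exp_add, ← mul_assoc, neg_mul]
    exact mul_le_mul_of_nonneg_right (hC s hs) (Real.exp_pos _).le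

theorem hasDerivAt_besselInt {a b c : ℝ} (ha : 0 ≤ a) (hb : 0 < b) (hc : 0 < c) :
    HasDerivAt (fun b => besselInt a b c) (-besselInt (a + 1) b c) b := by
  have key := hasDerivAt_integral_of_dominated_loc_of_deriv_le (μ := volume.restrict (Ioi (0 : ℝ)))
    (F := fun b s : ℝ => s ^ (-a) * Real.exp (-(b / s) - c * s))
    (F' := fun b s : ℝ => -(s ^ (-(a + 1)) * Real.exp (-(b / s) - c * s)))
    (bound := fun s : ℝ => s ^ (-(a + 1)) * Real.exp (-(b / 2 / s) - c * s))
    (x₀ := b) (s := Ioi (b / 2)) (Ioi_mem_nhds (by linarith)) ?_ ?_ ?_ ?_ ?_ ?_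
  · have := key.2
    rwa [integral_neg] at this
  · exact Eventually.of_forall fun b => (by fun_prop : Measurable _).aestronglyMeasurable
  · exact integrableOn_besselInt ha hb hc
  · exact (by fun_prop : Measurable _).aestronglyMeasurable
  · filter_upwards [ae_restrict_mem measurableSet_Ioi] with s hs b' hb'
    have hs : 0 < s := hs
    have hb' : b / 2 < b' := hb'
    rw [norm_neg, Real.norm_of_nonneg (by positivity)]
    gcongr
  · exact integrableOn_besselInt (by linarith) (by linarith) hc
  · filter_upwards [ae_restrict_mem measurableSet_Ioi] with s hs b' _
    have hs : 0 < s := hs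
    have h1 : HasDerivAt (fun b' : ℝ => -(b' / s) - c * s) (-(1 / s)) b' :=
      (((hasDerivAt_id b').div_const s).neg).sub_const _
    refine (h1.exp.const_mul (s ^ (-a))).congr_deriv ?_
    rw [neg_add, Real.rpow_add hs, Real.rpow_neg_one]
    ring

/-- The three-term recurrence of the Bessel-type integrals; it expresses that the derivative of
`s^(-a) exp (-b / s - c s)` has integral zero. -/
theorem besselInt_recurrence {a b c : ℝ} (ha : 0 < a) (hb : 0 < b) (hc : 0 < c) :
    b * besselInt (a + 2) b c - a * besselInt (a + 1) b c = c * besselInt a b c := by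
  set φ : ℝ → ℝ := fun s => s ^ (-a) * Real.exp (-(b / s) - c * s) with hφ
  have i0 := integrableOn_besselInt ha.le hb hc
  have i1 := integrableOn_besselInt (a := a + 1) (by linarith) hb hc
  have i2 := integrableOn_besselInt (a := a + 2) (by linarith) hb hc
  have key := integral_Ioi_of_hasDerivAt_of_tendsto (f := φ) (a := 0) (m := 0)
    (f' := fun s => b * (s ^ (-(a + 2)) * Real.exp (-(b / s) - c * s))
      - a * (s ^ (-(a + 1)) * Real.exp (-(b / s) - c * s))
      - c * (s ^ (-a) * Real.exp (-(b / s) - c * s))) ?_ ?_ ?_ ?_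
  · have hφ0 : φ 0 = 0 := by simp [hφ, Real.zero_rpow (neg_ne_zero.2 ha.ne')]
    have j : IntegrableOn (fun s => b * (s ^ (-(a + 2)) * Real.exp (-(b / s) - c * s))
      - a * (s ^ (-(a + 1)) * Real.exp (-(b / s) - c * s))) (Ioi 0) :=
      (i2.const_mul b).sub (i1.const_mul a)
    rw [integral_sub j (i0.const_mul c),
      integral_sub (i2.const_mul b) (i1.const_mul a), integral_const_mul, integral_const_mul,
      integral_const_mul, hφ0] at key
    simp only [besselInt]
    linarith
  · have hφ0 : φ 0 = 0 := by simp [hφ, Real.zero_rpow (neg_ne_zero.2 ha.ne')]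
    obtain ⟨C, hC0, hC⟩ := exists_rpow_mul_exp_neg_le (a := a + 1) (by linarith) hb
    -- `φ s = s * (s ^ (-(a + 1)) exp (-b / s)) * exp (-c s)` with a bounded middle factor.
    rw [ContinuousWithinAt, hφ0]
    have hlim : Tendsto (fun s : ℝ => C * s) (𝓝[Ici 0] 0) (𝓝 0) := by
      have : Tendsto (fun s : ℝ => C * s) (𝓝 0) (𝓝 (C * 0)) :=
        (continuous_const.mul continuous_id).tendsto 0
      rw [mul_zero] at this
      exact this.mono_left nhdsWithin_le_nhds
    refine squeeze_zero_norm' ?_ hlim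
    filter_upwards [self_mem_nhdsWithin] with s hs
    rcases (show (0 : ℝ) ≤ s from hs).eq_or_lt with rfl | hs
    · simp [hφ0]
    · rw [Real.norm_of_nonneg (by positivity)]
      have e1 : s ^ (-a) = s ^ (-(a + 1)) * s := by
        rw [neg_add, Real.rpow_add hs, Real.rpow_neg_one]; field_simp
      have e2 : Real.exp (-(b / s) - c * s) ≤ Real.exp (-(b / s)) := by
        gcongr; nlinarith [mul_pos hc hs]
      calc φ s ≤ s ^ (-a) * Real.exp (-(b / s)) := by simp only [hφ]; gcongr
        _ = s ^ (-(a + 1)) * Real.exp (-(b / s)) * s := by rw [e1]; ring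
        _ ≤ C * s := by gcongr; exact hC s hs
  · intro s hs
    have hs : 0 < s := hs
    have h1 : HasDerivAt (fun s : ℝ => -(b / s) - c * s) (b / s ^ 2 - c) s := by
      have := ((hasDerivAt_inv hs.ne').const_mul b).neg.sub ((hasDerivAt_id s).const_mul c)
      exact this.congr_deriv (by field_simp)
    have h2 := (Real.hasDerivAt_rpow_const (p := -a) (Or.inl hs.ne')).mul h1.exp
    refine h2.congr_deriv ?_
    have e1 : s ^ (-(a + 1)) = s ^ (-a) / s := by
      rw [neg_add, Real.rpow_add hs, Real.rpow_neg_one]; field_simp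
    have e2 : s ^ (-(a + 2)) = s ^ (-a) / s ^ 2 := by
      rw [neg_add, Real.rpow_add hs, Real.rpow_neg hs.le 2]; norm_cast
    have e3 : s ^ (-a - 1) = s ^ (-a) / s := by
      rw [sub_eq_add_neg, Real.rpow_add hs, Real.rpow_neg_one]; field_simp
    rw [e1, e2, e3]
    field_simp
    ring
  · exact ((i2.const_mul b).sub (i1.const_mul a)).sub (i0.const_mul c)
  · have hlim : Tendsto (fun s : ℝ => Real.exp (-c * s)) atTop (𝓝 0) :=
      Real.tendsto_exp_atBot.comp (tendsto_id.const_mul_atTop_of_neg (by linarith))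
    refine squeeze_zero_norm' ?_ hlim
    filter_upwards [eventually_ge_atTop 1] with s hs
    have hs0 : 0 < s := by linarith
    rw [Real.norm_of_nonneg (by positivity)]
    have e1 : s ^ (-a) ≤ 1 := Real.rpow_le_one_of_one_le_of_nonpos hs (by linarith)
    have e2 : Real.exp (-(b / s) - c * s) ≤ Real.exp (-c * s) := by
      gcongr; have := div_pos hb hs0; linarith
    calc φ s ≤ 1 * Real.exp (-c * s) := by simp only [hφ]; gcongr
      _ = _ := one_mul _

theorem besselInt_nonneg (a b c : ℝ) : 0 ≤ besselInt a b c :=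
  setIntegral_nonneg measurableSet_Ioi fun s hs => by
    have hs : 0 < s := hs
    positivity

/-- Exponential decay, from `b / (2 s) + c s / 2 ≥ √b √c`. -/
theorem besselInt_le {a b₀ b c : ℝ} (ha : 0 ≤ a) (hb₀ : 0 < b₀) (hb : b₀ ≤ b) (hc : 0 < c) :
    besselInt a b c ≤ besselInt a (b₀ / 2) (c / 2) * Real.exp (-(√b * √c)) := by
  have hb' : 0 < b := hb₀.trans_le hb
  rw [besselInt, besselInt, ← integral_mul_const]
  refine setIntegral_mono_on (integrableOn_besselInt ha hb' hc)
    ((integrableOn_besselInt ha (by linarith) (by linarith)).mul_const _) measurableSet_Ioi ?_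
  intro s hs
  have hs : 0 < s := hs
  rw [mul_assoc, ← Real.exp_add]
  gcongr
  have h1 : b₀ / 2 / s ≤ b / 2 / s := by gcongr
  have h2 : √b * √c ≤ b / 2 / s + c / 2 * s := by
    have hb2 := Real.sq_sqrt hb'.le
    have hc2 := Real.sq_sqrt hc.le
    rw [div_add' _ _ _ hs.ne', le_div_iff₀ hs]
    have h4 : (√b - √c * s) ^ 2 = b - 2 * (√b * √c * s) + c * s ^ 2 := by
      rw [sub_sq, mul_pow, hb2, hc2]; ring
    nlinarith [sq_nonneg (√b - √c * s)]
  have h3 : b / s = b / 2 / s + b / 2 / s := by ring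
  linarith

/-! ### Partial derivatives and the Laplacian -/

/-- The linear map `v ↦ ∑ i, v i • w i` on `ℝⁿ` with partial derivatives `w i`. -/
noncomputable def ofPartials {n : ℕ} (w : Fin n → ℂ) : EuclideanSpace ℝ (Fin n) →L[ℝ] ℂ :=
  ∑ i, ContinuousLinearMap.smulRightL ℝ (EuclideanSpace ℝ (Fin n)) ℂ
    (EuclideanSpace.proj i : EuclideanSpace ℝ (Fin n) →L[ℝ] ℝ) (w i)

theorem ofPartials_apply {n : ℕ} (w : Fin n → ℂ) (v : EuclideanSpace ℝ (Fin n)) :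
    ofPartials w v = ∑ i, v i • w i := by
  simp [ofPartials]

theorem ofPartials_single {n : ℕ} (w : Fin n → ℂ) (i : Fin n) :
    ofPartials w (EuclideanSpace.single i 1) = w i := by
  rw [ofPartials_apply, Finset.sum_eq_single i] <;> simp +contextual

theorem eq_ofPartials {n : ℕ} (L : EuclideanSpace ℝ (Fin n) →L[ℝ] ℂ) :
    L = ofPartials fun i => L (EuclideanSpace.single i 1) := by
  ext v
  rw [ofPartials_apply]
  conv_lhs => rw [← (EuclideanSpace.basisFun (Fin n) ℝ).sum_repr v]
  simp

theorem smul_ofPartials {n : ℕ} (c : ℂ) (w : Fin n → ℂ) :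
    c • ofPartials w = ofPartials fun i => c * w i := by
  ext v
  simp [ofPartials_apply, Finset.mul_sum, mul_left_comm]

theorem norm_ofPartials_le {n : ℕ} (w : Fin n → ℂ) : ‖ofPartials w‖ ≤ ∑ i, ‖w i‖ := by
  refine (norm_sum_le _ _).trans (Finset.sum_le_sum fun i _ => ?_)
  refine ContinuousLinearMap.opNorm_le_bound _ (norm_nonneg _) fun v => ?_
  simp only [ContinuousLinearMap.smulRightL_apply_apply, ContinuousLinearMap.smulRight_apply,
    norm_smul, mul_comm ‖w i‖]
  gcongr
  exact PiLp.norm_apply_le v i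

theorem hasSum_ofPartials {ι : Type*} {n : ℕ} {w : ι → Fin n → ℂ} {W : Fin n → ℂ}
    (h : ∀ i, HasSum (fun m => w m i) (W i)) : HasSum (fun m => ofPartials (w m)) (ofPartials W) :=
  hasSum_sum fun i _ => ContinuousLinearMap.hasSum _ (h i)

theorem contDiffOn_ofPartials {n : ℕ} {N : WithTop ℕ∞} {s : Set (EuclideanSpace ℝ (Fin n))}
    {w : Fin n → EuclideanSpace ℝ (Fin n) → ℂ} (h : ∀ i, ContDiffOn ℝ N (w i) s) :
    ContDiffOn ℝ N (fun x => ofPartials fun i => w i x) s :=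
  ContDiffOn.sum fun i _ => (ContinuousLinearMap.contDiff _).comp_contDiffOn (h i)

theorem hasFDerivAt_coord_mul {n : ℕ} {u : EuclideanSpace ℝ (Fin n) → ℂ} {w : Fin n → ℂ}
    {x : EuclideanSpace ℝ (Fin n)} (h : HasFDerivAt u (ofPartials w) x) (j : Fin n) :
    HasFDerivAt (fun x => (x j : ℂ) * u x)
      (ofPartials fun i => (if i = j then u x else 0) + x j * w i) x := by
  have h1 : HasFDerivAt (fun x : EuclideanSpace ℝ (Fin n) => (x j : ℂ))
      (Complex.ofRealCLM.comp (EuclideanSpace.proj j : EuclideanSpace ℝ (Fin n) →L[ℝ] ℝ)) x :=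
    (Complex.ofRealCLM.comp (EuclideanSpace.proj j :
      EuclideanSpace ℝ (Fin n) →L[ℝ] ℝ)).hasFDerivAt
  refine (h1.mul h).congr_fderiv ?_
  ext v
  simp [ofPartials_apply, Finset.mul_sum, Finset.sum_add_distrib, add_comm, mul_left_comm,
    mul_comm, mul_assoc]

theorem laplacian_eq_sum_of_partials {n : ℕ} {f : EuclideanSpace ℝ (Fin n) → ℂ}
    {f' : Fin n → EuclideanSpace ℝ (Fin n) → ℂ} {f'' : Fin n → Fin n → ℂ}
    {x : EuclideanSpace ℝ (Fin n)}
    (h1 : ∀ᶠ y in 𝓝 x, HasFDerivAt f (ofPartials fun i => f' i y) y)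
    (h2 : ∀ i, HasFDerivAt (f' i) (ofPartials (f'' i)) x) : (Δ f) x = ∑ i, f'' i i := by
  rw [InnerProductSpace.laplacian_eq_iteratedFDeriv_orthonormalBasis f
    (EuclideanSpace.basisFun (Fin n) ℝ)]
  have e1 : fderiv ℝ f =ᶠ[𝓝 x] fun y => ofPartials fun i => f' i y :=
    h1.mono fun y hy => hy.fderiv
  have e2 : HasFDerivAt (fun y => ofPartials fun i => f' i y)
      (∑ i, (ContinuousLinearMap.smulRightL ℝ (EuclideanSpace ℝ (Fin n)) ℂ
        (EuclideanSpace.proj i : EuclideanSpace ℝ (Fin n) →L[ℝ] ℝ)).comp (ofPartials (f'' i))) x :=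
    HasFDerivAt.fun_sum fun i _ => (ContinuousLinearMap.hasFDerivAt _).comp x (h2 i)
  refine Finset.sum_congr rfl fun i _ => ?_
  rw [iteratedFDeriv_two_apply, e1.fderiv_eq, e2.fderiv]
  simp only [sum_apply, Matrix.cons_val_zero, Matrix.cons_val_one,
    EuclideanSpace.basisFun_apply, ContinuousLinearMap.comp_apply, ofPartials_single]
  rw [Finset.sum_eq_single i] <;> simp +contextual

/-! ### Functions of rapid decay, smooth away from the origin -/

/-- `u` decays faster than every power of `‖x‖`, uniformly outside every ball around `0`. -/
def RapidDecay {n : ℕ} (u : EuclideanSpace ℝ (Fin n) → ℂ) : Prop :=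
  ∀ δ : ℝ, 0 < δ → ∀ p : ℕ, ∃ C : ℝ, ∀ x, δ ≤ ‖x‖ → (1 + ‖x‖) ^ p * ‖u x‖ ≤ C

/-- `u` is `N` times differentiable on `ℝⁿ \ {0}` and all partial derivatives of order at most `N`
decay rapidly. The definition is recursive in the order, the partial derivatives being given as
functions on all of `ℝⁿ` whose values at `0` are irrelevant. -/
def RapidSmooth {n : ℕ} : ℕ → (EuclideanSpace ℝ (Fin n) → ℂ) → Prop
  | 0, u => RapidDecay u
  | N + 1, u => RapidDecay u ∧ ∃ u' : Fin n → EuclideanSpace ℝ (Fin n) → ℂ,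
      (∀ i, RapidSmooth N (u' i)) ∧
        ∀ x, x ≠ 0 → HasFDerivAt u (ofPartials fun i => u' i x) x

namespace RapidDecay

variable {n : ℕ} {u v : EuclideanSpace ℝ (Fin n) → ℂ}

theorem zero : RapidDecay (fun _ : EuclideanSpace ℝ (Fin n) => (0 : ℂ)) :=
  fun _ _ _ => ⟨0, by simp⟩

theorem add (hu : RapidDecay u) (hv : RapidDecay v) : RapidDecay fun x => u x + v x := by
  intro δ hδ p
  obtain ⟨C, hC⟩ := hu δ hδ p
  obtain ⟨D, hD⟩ := hv δ hδ p
  refine ⟨C + D, fun x hx => ?_⟩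
  calc (1 + ‖x‖) ^ p * ‖u x + v x‖ ≤ (1 + ‖x‖) ^ p * (‖u x‖ + ‖v x‖) := by
        gcongr; exact norm_add_le _ _
    _ ≤ C + D := by rw [mul_add]; exact add_le_add (hC x hx) (hD x hx)

theorem const_mul (hu : RapidDecay u) (c : ℂ) : RapidDecay fun x => c * u x := by
  intro δ hδ p
  obtain ⟨C, hC⟩ := hu δ hδ p
  refine ⟨‖c‖ * C, fun x hx => ?_⟩
  rw [norm_mul, mul_left_comm]
  exact mul_le_mul_of_nonneg_left (hC x hx) (norm_nonneg c)

theorem coord_mul (hu : RapidDecay u) (j : Fin n) : RapidDecay fun x => (x j : ℂ) * u x := by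
  intro δ hδ p
  obtain ⟨C, hC⟩ := hu δ hδ (p + 1)
  refine ⟨C, fun x hx => le_trans ?_ (hC x hx)⟩
  have h1 : ‖(x j : ℂ)‖ ≤ 1 + ‖x‖ := by
    rw [Complex.norm_real]; linarith [PiLp.norm_apply_le x j]
  rw [norm_mul, pow_succ, mul_assoc]
  gcongr

end RapidDecay

namespace RapidSmooth

variable {n N : ℕ} {u v : EuclideanSpace ℝ (Fin n) → ℂ}

theorem rapidDecay (hu : RapidSmooth N u) : RapidDecay u := by
  cases N with
  | zero => exact hu
  | succ N => exact hu.1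

theorem of_succ (hu : RapidSmooth (N + 1) u) : RapidSmooth N u := by
  induction N generalizing u with
  | zero => exact hu.1
  | succ N ih =>
    obtain ⟨h0, u', h1, h2⟩ := hu
    exact ⟨h0, u', fun i => ih (h1 i), h2⟩

theorem zero : RapidSmooth N (fun _ : EuclideanSpace ℝ (Fin n) => (0 : ℂ)) := by
  induction N with
  | zero => exact RapidDecay.zero
  | succ N ih =>
    refine ⟨RapidDecay.zero, fun _ _ => 0, fun _ => ih, fun x _ => ?_⟩
    refine (hasFDerivAt_const _ _).congr_fderiv ?_
    ext v
    simp [ofPartials_apply]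

theorem add (hu : RapidSmooth N u) (hv : RapidSmooth N v) :
    RapidSmooth N fun x => u x + v x := by
  induction N generalizing u v with
  | zero => exact RapidDecay.add hu hv
  | succ N ih =>
    obtain ⟨h0, u', h1, h2⟩ := hu
    obtain ⟨k0, v', k1, k2⟩ := hv
    refine ⟨h0.add k0, fun i x => u' i x + v' i x, fun i => ih (h1 i) (k1 i), fun x hx => ?_⟩
    refine ((h2 x hx).add (k2 x hx)).congr_fderiv ?_
    ext w
    simp [ofPartials_apply, Finset.sum_add_distrib]

theorem const_mul (hu : RapidSmooth N u) (c : ℂ) : RapidSmooth N fun x => c * u x := by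
  induction N generalizing u with
  | zero => exact RapidDecay.const_mul hu c
  | succ N ih =>
    obtain ⟨h0, u', h1, h2⟩ := hu
    refine ⟨h0.const_mul c, fun i x => c * u' i x, fun i => ih (h1 i), fun x hx => ?_⟩
    exact ((h2 x hx).const_mul c).congr_fderiv (smul_ofPartials c _)

theorem coord_mul (hu : RapidSmooth N u) (j : Fin n) :
    RapidSmooth N fun x => (x j : ℂ) * u x := by
  induction N generalizing u with
  | zero => exact RapidDecay.coord_mul hu j
  | succ N ih =>
    have hu' := hu.of_succ
    obtain ⟨h0, u', h1, h2⟩ := hu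
    refine ⟨h0.coord_mul j, fun i x => (if i = j then u x else 0) + x j * u' i x,
      fun i => RapidSmooth.add ?_ (ih (h1 i)), fun x hx => hasFDerivAt_coord_mul (h2 x hx) j⟩
    by_cases hij : i = j
    · simpa [hij] using hu'
    · simpa [hij] using zero

theorem laplacian_const_mul (hu : RapidSmooth 2 u) (c : ℂ) {x : EuclideanSpace ℝ (Fin n)}
    (hx : x ≠ 0) : (Δ fun y => c * u y) x = c * (Δ u) x := by
  obtain ⟨-, u', h1, h2⟩ := hu
  choose g0 u'' g1 g2 using h1
  rw [laplacian_eq_sum_of_partials ((eventually_ne_nhds hx).mono fun y hy => h2 y hy)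
    fun i => g2 i x hx, laplacian_eq_sum_of_partials (f' := fun i y => c * u' i y)
    (f'' := fun i j => c * u'' i j x)
    ((eventually_ne_nhds hx).mono fun y hy =>
      ((h2 y hy).const_mul c).congr_fderiv (smul_ofPartials c _))
    fun i => ((g2 i x hx).const_mul c).congr_fderiv (smul_ofPartials c _), Finset.mul_sum]

end RapidSmooth

/-! ### The Bessel-type integrals as functions on `ℝⁿ` -/

theorem exists_pow_mul_exp_neg_le (p : ℕ) {κ : ℝ} (hκ : 0 < κ) :
    ∃ C : ℝ, ∀ r : ℝ, 0 ≤ r → (1 + r) ^ p * Real.exp (-(κ * r)) ≤ C := by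
  refine ⟨p.factorial / κ ^ p * Real.exp κ, fun r hr => ?_⟩
  have h := Real.pow_div_factorial_le_exp (κ * (1 + r)) (by positivity) p
  rw [div_le_iff₀ (by positivity), mul_pow] at h
  have h1 : (1 + r) ^ p ≤ p.factorial / κ ^ p * Real.exp (κ * (1 + r)) := by
    rw [div_mul_eq_mul_div, le_div_iff₀ (by positivity)]; linarith
  calc (1 + r) ^ p * Real.exp (-(κ * r))
      ≤ p.factorial / κ ^ p * Real.exp (κ * (1 + r)) * Real.exp (-(κ * r)) := by gcongr
    _ = p.factorial / κ ^ p * Real.exp κ := by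
        rw [mul_assoc, ← Real.exp_add]; congr 2; ring

/-- The radial function `x ↦ ∫_0^∞ s^(-a) exp (-‖x‖² / (4 s) - c s) ds`. -/
noncomputable def besselRadial (n : ℕ) (a c : ℝ) (x : EuclideanSpace ℝ (Fin n)) : ℂ :=
  (besselInt a (‖x‖ ^ 2 / 4) c : ℂ)

theorem rapidDecay_besselRadial (n : ℕ) {a c : ℝ} (ha : 0 ≤ a) (hc : 0 < c) :
    RapidDecay (besselRadial n a c) := by
  intro δ hδ p
  obtain ⟨C, hC⟩ := exists_pow_mul_exp_neg_le p (κ := √c / 2) (by positivity)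
  refine ⟨C * besselInt a (δ ^ 2 / 4 / 2) (c / 2), fun x hx => ?_⟩
  -- The rate `√c / 2` is `√b √c / ‖x‖` at `b = ‖x‖² / 4`.
  have h1 := besselInt_le (b₀ := δ ^ 2 / 4) (b := ‖x‖ ^ 2 / 4) ha (by positivity) (by gcongr) hc
  have h2 : √(‖x‖ ^ 2 / 4) = ‖x‖ / 2 := by
    rw [show ‖x‖ ^ 2 / 4 = (‖x‖ / 2) ^ 2 by ring, Real.sqrt_sq (by positivity)]
  rw [h2, show ‖x‖ / 2 * √c = √c / 2 * ‖x‖ by ring] at h1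
  rw [besselRadial, Complex.norm_real, Real.norm_of_nonneg (besselInt_nonneg _ _ _)]
  calc _ ≤ (1 + ‖x‖) ^ p * (besselInt a (δ ^ 2 / 4 / 2) (c / 2) *
          Real.exp (-(√c / 2 * ‖x‖))) := by gcongr
    _ = ((1 + ‖x‖) ^ p * Real.exp (-(√c / 2 * ‖x‖))) * besselInt a (δ ^ 2 / 4 / 2) (c / 2) := by
        ring
    _ ≤ _ := mul_le_mul_of_nonneg_right (hC _ (norm_nonneg x)) (besselInt_nonneg _ _ _)

theorem hasFDerivAt_besselRadial {n : ℕ} {a c : ℝ} (ha : 0 ≤ a) (hc : 0 < c)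
    {x : EuclideanSpace ℝ (Fin n)} (hx : x ≠ 0) :
    HasFDerivAt (besselRadial n a c)
      (ofPartials fun i => -(1 / 2) * (x i * besselRadial n (a + 1) c x)) x := by
  have hx' : 0 < ‖x‖ := norm_pos_iff.2 hx
  have h1 : HasFDerivAt (fun x : EuclideanSpace ℝ (Fin n) => ‖x‖ ^ 2 / 4)
      ((4⁻¹ : ℝ) • (2 • innerSL ℝ x)) x := by
    simpa [div_eq_inv_mul] using
      (hasStrictFDerivAt_norm_sq x).hasFDerivAt.const_mul (4⁻¹ : ℝ)
  have h2 := (hasDerivAt_besselInt (b := ‖x‖ ^ 2 / 4) ha (by positivity) hc).ofReal_comp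
  refine (h2.hasFDerivAt.comp x h1).congr_fderiv ?_
  ext v
  simp only [besselRadial, ofPartials_apply, ContinuousLinearMap.comp_apply,
    ContinuousLinearMap.toSpanSingleton_apply, smul_apply, innerSL_apply_apply,
    PiLp.inner_apply, RCLike.inner_apply, conj_trivial, Complex.real_smul, smul_eq_mul]
  push_cast
  rw [nsmul_eq_mul, Finset.mul_sum, Finset.mul_sum, Finset.sum_mul]
  refine Finset.sum_congr rfl fun i _ => ?_
  push_cast
  ring

theorem rapidSmooth_besselRadial (n N : ℕ) {a c : ℝ} (ha : 0 ≤ a) (hc : 0 < c) :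
    RapidSmooth N (besselRadial n a c) := by
  induction N generalizing a with
  | zero => exact rapidDecay_besselRadial n ha hc
  | succ N ih =>
    exact ⟨rapidDecay_besselRadial n ha hc, _,
      fun i => ((ih (a := a + 1) (by linarith)).coord_mul i).const_mul _,
      fun x hx => hasFDerivAt_besselRadial ha hc hx⟩

/-- The choice `a = n / 2` makes the radial function a solution of `(Δ - c) u = 0`. -/
theorem laplacian_besselRadial {n : ℕ} (hn : 0 < n) {c : ℝ} (hc : 0 < c)
    {x : EuclideanSpace ℝ (Fin n)} (hx : x ≠ 0) :
    (Δ (besselRadial n (n / 2) c)) x = c * besselRadial n (n / 2) c x := by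
  have hx' : 0 < ‖x‖ := norm_pos_iff.2 hx
  have hn' : (0 : ℝ) < n / 2 := by positivity
  rw [laplacian_eq_sum_of_partials
    (f' := fun i y => -(1 / 2) * (y i * besselRadial n (n / 2 + 1) c y))
    ((eventually_ne_nhds hx).mono fun y hy => hasFDerivAt_besselRadial hn'.le hc hy)
    (f'' := fun j i => -(1 / 2) * ((if i = j then besselRadial n (n / 2 + 1) c x else 0) +
      x j * (-(1 / 2) * (x i * besselRadial n (n / 2 + 1 + 1) c x)))) ?_]
  · have hrec := besselInt_recurrence (b := ‖x‖ ^ 2 / 4) hn' (by positivity) hc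
    -- The trace of the Hessian is `(‖x‖² / 4) B_{a+2} - (n / 2) B_{a+1}`, with `B_a` the radial
    -- function, to which the recurrence applies for `a = n / 2`.
    have hsq : (∑ i, (x i : ℂ) ^ 2) = (‖x‖ : ℂ) ^ 2 := by
      rw [← Complex.ofReal_pow, EuclideanSpace.real_norm_sq_eq]; push_cast; rfl
    have hs : (∑ i : Fin n, -(1 / 2 : ℂ) * ((if i = i then besselRadial n (n / 2 + 1) c x else 0) +
        x i * (-(1 / 2) * (x i * besselRadial n (n / 2 + 1 + 1) c x)))) =
        1 / 4 * (∑ i, (x i : ℂ) ^ 2) * besselRadial n (n / 2 + 1 + 1) c x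
          - n / 2 * besselRadial n (n / 2 + 1) c x := by
      rw [Finset.mul_sum, Finset.sum_mul]
      simp only [if_true, mul_add, Finset.sum_add_distrib, Finset.sum_const, Finset.card_univ,
        Fintype.card_fin, nsmul_eq_mul]
      rw [add_comm, sub_eq_add_neg]
      congr 1
      · exact Finset.sum_congr rfl fun i _ => by ring
      · ring
    rw [hs, hsq]
    simp only [besselRadial]
    rw [add_assoc, one_add_one_eq_two, ← Complex.ofReal_mul c, ← hrec]
    push_cast
    ring
  · intro j
    have h := (hasFDerivAt_coord_mul
      (hasFDerivAt_besselRadial (a := n / 2 + 1) (by positivity) hc hx) j).const_mul (-(1 / 2) : ℂ)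
    exact h.congr_fderiv (smul_ofPartials _ _)

/-! ### The lattice -/

section Lattice

variable {n k : ℕ}

theorem latticeVec_apply_of_lt (m : Fin k → ℤ) {i : Fin n} (h : (i : ℕ) < k) :
    latticeVec n m i = m ⟨i, h⟩ := by
  simp [latticeVec, h]

theorem latticeVec_apply_of_le (m : Fin k → ℤ) {i : Fin n} (h : k ≤ (i : ℕ)) :
    latticeVec n m i = 0 := by
  simp [latticeVec, h.not_gt]

theorem latticeVec_add (m m' : Fin k → ℤ) :
    latticeVec n (m + m') = latticeVec n m + latticeVec n m' := by
  ext i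
  by_cases h : (i : ℕ) < k <;> simp [latticeVec, h]

theorem latticeVec_neg (m : Fin k → ℤ) : latticeVec n (-m) = -latticeVec n m := by
  ext i
  by_cases h : (i : ℕ) < k <;> simp [latticeVec, h]

theorem isClosed_latticeSet (hkn : k ≤ n) : IsClosed (latticeSet n k) := by
  have h : latticeSet n k = ⋂ i : Fin n, {x : EuclideanSpace ℝ (Fin n) |
      x i ∈ if (i : ℕ) < k then range ((↑) : ℤ → ℝ) else {0}} := by
    ext x
    simp only [mem_iInter, mem_ofPred_eq]
    constructor
    · rintro ⟨m, rfl⟩ i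
      by_cases h : (i : ℕ) < k
      · simp only [h, if_true, latticeVec_apply_of_lt]
        exact mem_range_self _
      · simp [h, latticeVec]
    · intro hx
      have h1 : ∀ i : Fin k, ∃ a : ℤ, (a : ℝ) = x ⟨i, i.2.trans_le hkn⟩ := fun i => by
        simpa using hx ⟨i, i.2.trans_le hkn⟩
      choose m hm using h1
      refine ⟨m, ?_⟩
      ext i
      by_cases h : (i : ℕ) < k
      · rw [latticeVec_apply_of_lt m h, hm]
      · have := hx i
        simp only [h, if_false, mem_singleton_iff] at this
        rw [this, latticeVec_apply_of_le m (not_lt.1 h)]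
  rw [h]
  refine isClosed_iInter fun i => IsClosed.preimage (by fun_prop) ?_
  split_ifs
  · exact Int.isClosedEmbedding_coe_real.isClosed_range
  · exact isClosed_singleton

theorem add_latticeVec_mem_iff {x : EuclideanSpace ℝ (Fin n)} {m : Fin k → ℤ} :
    x + latticeVec n m ∈ latticeSet n k ↔ x ∈ latticeSet n k := by
  constructor
  · rintro ⟨m', h⟩
    refine ⟨m' - m, ?_⟩
    dsimp only at h ⊢
    rw [sub_eq_add_neg, latticeVec_add, latticeVec_neg, h]
    abel
  · rintro ⟨m', rfl⟩
    exact ⟨m' + m, latticeVec_add m' m⟩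

theorem zero_mem_latticeSet : (0 : EuclideanSpace ℝ (Fin n)) ∈ latticeSet n k :=
  ⟨0, by ext i; simp [latticeVec]⟩

theorem add_latticeVec_ne_zero {x : EuclideanSpace ℝ (Fin n)} (hx : x ∉ latticeSet n k)
    (m : Fin k → ℤ) : x + latticeVec n m ≠ 0 := fun h =>
  hx (add_latticeVec_mem_iff.1 (h ▸ zero_mem_latticeSet))

theorem abs_le_norm_latticeVec (hkn : k ≤ n) (m : Fin k → ℤ) (i : Fin k) :
    |(m i : ℝ)| ≤ ‖latticeVec n m‖ := by
  have h := PiLp.norm_apply_le (latticeVec n m) ⟨i, i.2.trans_le hkn⟩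
  rwa [latticeVec_apply_of_lt m (i := ⟨i, i.2.trans_le hkn⟩) i.2, Real.norm_eq_abs] at h

theorem summable_prod_fin {f : ℤ → ℝ} (hf0 : ∀ a, 0 ≤ f a) (hf : Summable f) (k : ℕ) :
    Summable fun m : Fin k → ℤ => ∏ i, f (m i) := by
  induction k with
  | zero => exact Summable.of_finite
  | succ k ih =>
    rw [← (Fin.consEquiv fun _ : Fin (k + 1) => ℤ).summable_iff]
    refine (hf.mul_of_nonneg ih hf0 fun m => Finset.prod_nonneg fun i _ => hf0 _).congr
      fun p => ?_
    simp [Fin.prod_univ_succ, Fin.consEquiv]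

theorem summable_prod_inv_sq (k : ℕ) :
    Summable fun m : Fin k → ℤ => ∏ i, ((1 + |(m i : ℝ)|) ^ 2)⁻¹ := by
  refine summable_prod_fin (f := fun a : ℤ => ((1 + |(a : ℝ)|) ^ 2)⁻¹) (fun a => by positivity)
    ?_ k
  have h : Summable fun a : ℕ => ((1 + (a : ℝ)) ^ 2)⁻¹ := by
    have := (summable_nat_add_iff 1).2 (Real.summable_nat_pow_inv.2 one_lt_two)
    simpa [add_comm] using this
  exact Summable.of_nat_of_neg (by simpa using h) (by simpa using h)

end Lattice

/-! ### Periodization -/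

section Periodization

variable {n k : ℕ}

/-- The translates of a rapidly decaying function by the lattice are dominated, on a compact set
without lattice points, by a summable family. -/
theorem RapidDecay.exists_summable_bound (hkn : k ≤ n) {u : EuclideanSpace ℝ (Fin n) → ℂ}
    (hu : RapidDecay u) {K : Set (EuclideanSpace ℝ (Fin n))} (hK : IsCompact K)
    (hKL : K ⊆ (latticeSet n k)ᶜ) :
    ∃ v : (Fin k → ℤ) → ℝ, Summable v ∧ ∀ m, ∀ x ∈ K, ‖u (x + latticeVec n m)‖ ≤ v m := by
  obtain ⟨δ, hδ, hKδ⟩ := hK.exists_thickening_subset_open (isClosed_latticeSet hkn).isOpen_compl hKL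
  obtain ⟨R, hR⟩ := hK.isBounded.exists_norm_le
  -- Order `2 k` of decay gives a factor `(1 + |m_i|)⁻²` for each of the `k` coordinates.
  obtain ⟨C, hC⟩ := hu δ hδ (2 * k)
  have hR' : ∀ x ∈ K, 0 ≤ R := fun x hx => (norm_nonneg x).trans (hR x hx)
  refine ⟨fun m => C * (1 + R) ^ (2 * k) * ∏ i, ((1 + |(m i : ℝ)|) ^ 2)⁻¹,
    (summable_prod_inv_sq k).mul_left _, fun m x hx => ?_⟩
  have h1 : δ ≤ ‖x + latticeVec n m‖ := by
    by_contra! h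
    refine hKδ (Metric.mem_thickening_iff.2 ⟨x, hx, ?_⟩) ⟨-m, rfl⟩
    dsimp only
    rwa [latticeVec_neg, dist_comm, dist_eq_norm, sub_neg_eq_add]
  have h2 := hC _ h1
  have h3 : ∀ i, 1 + |(m i : ℝ)| ≤ (1 + R) * (1 + ‖x + latticeVec n m‖) := fun i => by
    have a1 := abs_le_norm_latticeVec hkn m i
    have a2 : ‖latticeVec n m‖ ≤ ‖x + latticeVec n m‖ + ‖x‖ := by
      simpa using norm_sub_le (x + latticeVec n m) x
    nlinarith [hR x hx, hR' x hx, norm_nonneg (x + latticeVec n m)]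
  have h4 : ∏ i, (1 + |(m i : ℝ)|) ^ 2 ≤ ((1 + R) * (1 + ‖x + latticeVec n m‖)) ^ (2 * k) := by
    have : ∏ i, (1 + |(m i : ℝ)|) ^ 2 ≤
        ∏ _i : Fin k, ((1 + R) * (1 + ‖x + latticeVec n m‖)) ^ 2 :=
      Finset.prod_le_prod (fun i _ => by positivity) fun i _ =>
        pow_le_pow_left₀ (by positivity) (h3 i) 2
    rwa [Finset.prod_const, Finset.card_univ, Fintype.card_fin, ← pow_mul] at this
  dsimp only
  rw [Finset.prod_inv_distrib, ← div_eq_mul_inv, le_div_iff₀ (by positivity)]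
  have hR0 := hR' x hx
  calc ‖u (x + latticeVec n m)‖ * ∏ i, (1 + |(m i : ℝ)|) ^ 2
      ≤ ‖u (x + latticeVec n m)‖ * ((1 + R) * (1 + ‖x + latticeVec n m‖)) ^ (2 * k) := by gcongr
    _ = (1 + ‖x + latticeVec n m‖) ^ (2 * k) * ‖u (x + latticeVec n m)‖ * (1 + R) ^ (2 * k) := by
        rw [mul_pow]; ring
    _ ≤ C * (1 + R) ^ (2 * k) := by gcongr

/-- The twisted periodization `∑_m χ(m) u(x + m)` of `u` over the lattice `Λ_k`. -/
noncomputable def periodize (χ : (Fin k → ℤ) → ℂ) (u : EuclideanSpace ℝ (Fin n) → ℂ)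
    (x : EuclideanSpace ℝ (Fin n)) : ℂ :=
  ∑' m, χ m * u (x + latticeVec n m)

variable {χ : (Fin k → ℤ) → ℂ} {u : EuclideanSpace ℝ (Fin n) → ℂ}

theorem RapidDecay.exists_summable_bound_twisted (hkn : k ≤ n) (hχ : ∀ m, ‖χ m‖ ≤ 1)
    (hu : RapidDecay u) {K : Set (EuclideanSpace ℝ (Fin n))} (hK : IsCompact K)
    (hKL : K ⊆ (latticeSet n k)ᶜ) :
    ∃ v : (Fin k → ℤ) → ℝ, Summable v ∧
      ∀ m, ∀ x ∈ K, ‖χ m * u (x + latticeVec n m)‖ ≤ v m := by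
  obtain ⟨v, hv, h⟩ := hu.exists_summable_bound hkn hK hKL
  refine ⟨v, hv, fun m x hx => ?_⟩
  rw [norm_mul]
  exact (mul_le_of_le_one_left (norm_nonneg _) (hχ m)).trans (h m x hx)

theorem RapidDecay.summable_periodize (hkn : k ≤ n) (hχ : ∀ m, ‖χ m‖ ≤ 1) (hu : RapidDecay u)
    {x : EuclideanSpace ℝ (Fin n)} (hx : x ∉ latticeSet n k) :
    Summable fun m => χ m * u (x + latticeVec n m) := by
  obtain ⟨v, hv, h⟩ := hu.exists_summable_bound_twisted hkn hχ isCompact_singleton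
    (singleton_subset_iff.2 hx)
  exact hv.of_norm_bounded fun m => h m x rfl

theorem hasFDerivAt_periodize (hkn : k ≤ n) (hχ : ∀ m, ‖χ m‖ ≤ 1) (hu : RapidDecay u)
    {u' : Fin n → EuclideanSpace ℝ (Fin n) → ℂ} (hu' : ∀ i, RapidDecay (u' i))
    (hd : ∀ x, x ≠ 0 → HasFDerivAt u (ofPartials fun i => u' i x) x)
    {x : EuclideanSpace ℝ (Fin n)} (hx : x ∉ latticeSet n k) :
    HasFDerivAt (periodize χ u) (ofPartials fun i => periodize χ (u' i) x) x := by
  obtain ⟨r, hr, hrL⟩ := Metric.nhds_basis_closedBall.mem_iff.1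
    ((isClosed_latticeSet hkn).isOpen_compl.mem_nhds hx)
  choose v hv hvb using fun i =>
    (hu' i).exists_summable_bound_twisted hkn hχ (isCompact_closedBall x r) hrL
  have hmem : x ∈ Metric.ball x r := Metric.mem_ball_self hr
  have key := hasFDerivAt_tsum_of_isPreconnected (𝕜 := ℝ) (u := fun m => ∑ i, v i m)
    (f := fun m y => χ m * u (y + latticeVec n m))
    (f' := fun m y => ofPartials fun i => χ m * u' i (y + latticeVec n m))
    (s := Metric.ball x r) (x₀ := x) (x := x) (summable_sum fun i _ => hv i) Metric.isOpen_ball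
    (convex_ball x r).isPreconnected ?_ ?_ hmem (hu.summable_periodize hkn hχ hx) hmem
  · refine key.congr_fderiv (HasSum.tsum_eq (hasSum_ofPartials fun i => ?_))
    exact ((hu' i).summable_periodize hkn hχ hx).hasSum
  · intro m y hy
    have hy0 := add_latticeVec_ne_zero (hrL (Metric.ball_subset_closedBall hy)) m
    have h1 := ((hd _ hy0).comp y ((hasFDerivAt_id y).add_const (latticeVec n m))).const_mul (χ m)
    exact h1.congr_fderiv (smul_ofPartials _ _)
  · intro m y hy
    exact (norm_ofPartials_le _).trans (Finset.sum_le_sum fun i _ =>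
      hvb i m y (Metric.ball_subset_closedBall hy))

/-- One order of differentiability is lost because continuity is deduced from
differentiability. -/
theorem contDiffOn_periodize (hkn : k ≤ n) (hχ : ∀ m, ‖χ m‖ ≤ 1) (N : ℕ)
    (hu : RapidSmooth (N + 1) u) : ContDiffOn ℝ N (periodize χ u) (latticeSet n k)ᶜ := by
  induction N generalizing u with
  | zero =>
    obtain ⟨h0, u', h1, h2⟩ := hu
    exact contDiffOn_zero.2 fun x hx =>
      (hasFDerivAt_periodize hkn hχ h0 (fun i => (h1 i).rapidDecay)
        h2 hx).continuousAt.continuousWithinAt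
  | succ N ih =>
    obtain ⟨h0, u', h1, h2⟩ := hu
    have hd := fun x hx => hasFDerivAt_periodize (x := x) hkn hχ h0
      (fun i => (h1 i).rapidDecay) h2 hx
    push_cast
    rw [contDiffOn_succ_iff_fderiv_of_isOpen (isClosed_latticeSet hkn).isOpen_compl]
    refine ⟨fun x hx => (hd x hx).differentiableAt.differentiableWithinAt, by simp, ?_⟩
    exact (contDiffOn_ofPartials fun i => ih (h1 i)).congr fun x hx => (hd x hx).fderiv

theorem laplacian_periodize (hkn : k ≤ n) (hχ : ∀ m, ‖χ m‖ ≤ 1) (hu : RapidSmooth 2 u)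
    {x : EuclideanSpace ℝ (Fin n)} (hx : x ∉ latticeSet n k) :
    (Δ (periodize χ u)) x = periodize χ (Δ u) x := by
  obtain ⟨h0, u', h1, h2⟩ := hu
  choose g0 u'' g1 g2 using h1
  rw [laplacian_eq_sum_of_partials
    (((isClosed_latticeSet hkn).isOpen_compl.eventually_mem hx).mono fun y hy =>
      hasFDerivAt_periodize hkn hχ h0 g0 h2 hy)
    (fun i => hasFDerivAt_periodize hkn hχ (g0 i) (g1 i) (g2 i) hx)]
  simp only [periodize]
  rw [← Summable.tsum_finsetSum fun i _ => (g1 i i).rapidDecay.summable_periodize hkn hχ hx]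
  refine tsum_congr fun m => ?_
  have hm := add_latticeVec_ne_zero hx m
  rw [← Finset.mul_sum, laplacian_eq_sum_of_partials
    ((eventually_ne_nhds hm).mono fun y hy => h2 y hy) fun i => g2 i _ hm]

end Periodization

/-! ### The fundamental solution of the Klein-Gordon operator in Euclidean space -/

section HankelBessel

theorem sphereArea_mul_Gamma {n : ℕ} (hn : 0 < n) :
    sphereArea n * Real.Gamma ((n : ℝ) / 2) = 2 * Real.pi ^ ((n : ℝ) / 2) := by
  have : Nonempty (Fin n) := ⟨⟨0, hn⟩⟩
  have hn' : (0 : ℝ) < n / 2 := by positivity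
  have hG := Real.Gamma_pos_of_pos hn'
  have hG' := Real.Gamma_pos_of_pos (by linarith : (0 : ℝ) < n / 2 + 1)
  have hp : √Real.pi ^ n = Real.pi ^ ((n : ℝ) / 2) := by
    rw [Real.sqrt_eq_rpow, ← Real.rpow_natCast, ← Real.rpow_mul Real.pi_pos.le]
    congr 1
    ring
  rw [sphereArea, Measure.toSphere_apply_univ, EuclideanSpace.volume_ball, finrank_euclideanSpace]
  simp only [Fintype.card_fin, ENNReal.ofReal_one, one_pow, one_mul, ENNReal.toReal_mul,
    ENNReal.toReal_natCast]
  rw [ENNReal.toReal_ofReal (by positivity), Real.Gamma_add_one hn'.ne', hp]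
  field_simp

/-- Sommerfeld's integral becomes a Bessel-type integral under `s = r / (2 α) * exp t`. -/
theorem integral_exp_neg_cosh {α r ν : ℝ} (hα : 0 < α) (hr : 0 < r) :
    ∫ t : ℝ, Real.exp (-(α * r * Real.cosh t) - ν * t) =
      (r / (2 * α)) ^ ν * besselInt (ν + 1) (r ^ 2 / 4) (α ^ 2) := by
  set q := r / (2 * α) with hq
  have hq0 : 0 < q := by positivity
  have himage : (fun t : ℝ => q * Real.exp t) '' univ = Ioi 0 := by
    ext s
    constructor
    · rintro ⟨t, -, rfl⟩
      exact mul_pos hq0 (Real.exp_pos t)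
    · intro hs
      refine ⟨Real.log (s / q), trivial, ?_⟩
      dsimp only
      rw [Real.exp_log (div_pos hs hq0)]
      field_simp
  have key := integral_image_eq_integral_abs_deriv_smul (s := univ)
    (f := fun t => q * Real.exp t) (f' := fun t => q * Real.exp t) MeasurableSet.univ
    (fun t _ => ((Real.hasDerivAt_exp t).const_mul q).hasDerivWithinAt)
    (fun t _ t' _ h => Real.exp_injective (mul_left_cancel₀ hq0.ne' h))
    (fun s => s ^ (-(ν + 1)) * Real.exp (-(r ^ 2 / 4 / s) - α ^ 2 * s))
  rw [himage] at key
  rw [besselInt, key, Measure.restrict_univ, ← integral_const_mul]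
  congr 1
  ext t
  have hqe : 0 < q * Real.exp t := mul_pos hq0 (Real.exp_pos t)
  have e1 : q * Real.exp t * (q * Real.exp t) ^ (-(ν + 1)) = q ^ (-ν) * Real.exp (-(ν * t)) := by
    rw [neg_add, Real.rpow_add hqe, Real.rpow_neg_one, mul_comm, mul_assoc,
      inv_mul_cancel₀ hqe.ne', mul_one, Real.mul_rpow hq0.le (Real.exp_pos t).le, ← Real.exp_mul]
    congr 2
    ring
  have e2 : r ^ 2 / 4 / (q * Real.exp t) + α ^ 2 * (q * Real.exp t) = α * r * Real.cosh t := by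
    rw [Real.cosh_eq, Real.exp_neg, hq]
    field_simp
    ring
  have e3 : q ^ ν * q ^ (-ν) = 1 := by rw [← Real.rpow_add hq0]; simp
  rw [smul_eq_mul, abs_of_pos hqe, ← mul_assoc (q * Real.exp t), e1, mul_assoc (q ^ (-ν)),
    ← mul_assoc, e3, one_mul, ← Real.exp_add]
  congr 1
  rw [← e2]
  ring

theorem hankelOne_I_mul {α r ν : ℝ} (hα : 0 < α) (hr : 0 < r) :
    hankelOne ν (Complex.I * α * r) =
      Complex.exp (-(ν * Real.pi * Complex.I / 2)) / (Real.pi * Complex.I) *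
        ((r / (2 * α)) ^ ν * besselInt (ν + 1) (r ^ 2 / 4) (α ^ 2) : ℝ) := by
  rw [hankelOne, ← integral_exp_neg_cosh hα hr, ← integral_complex_ofReal]
  congr 2
  ext t
  push_cast
  congr 1
  linear_combination (α * r * Complex.cosh t : ℂ) * Complex.I_mul_I

theorem I_mul_div_two_cpow {α : ℝ} (hα : 0 < α) (ν : ℝ) :
    (Complex.I * α / 2) ^ (ν : ℂ) =
      ((α / 2) ^ ν : ℝ) * Complex.exp (ν * Real.pi * Complex.I / 2) := by
  have hα2 : 0 < α / 2 := by positivity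
  have h1 : Complex.I * α / 2 = ((α / 2 : ℝ) : ℂ) * Complex.I := by push_cast; ring
  have h2 : ((α / 2 : ℝ) : ℂ) * Complex.I ≠ 0 :=
    mul_ne_zero (Complex.ofReal_ne_zero.2 hα2.ne') Complex.I_ne_zero
  rw [h1, Complex.cpow_def_of_ne_zero h2, Complex.log_ofReal_mul hα2 Complex.I_ne_zero,
    Complex.log_I, Real.rpow_def_of_pos hα2]
  push_cast
  rw [← Complex.exp_add]
  congr 1
  ring

/-- Away from the origin `E_α` is, up to the factor `-(4 π)^(-n/2)`, the Laplace transform of the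
heat kernel at `α²`. -/
theorem euclideanKG_eq {n : ℕ} (hn : 0 < n) {α : ℝ} (hα : 0 < α)
    {x : EuclideanSpace ℝ (Fin n)} (hx : x ≠ 0) :
    euclideanKG n α x =
      -((4 * Real.pi) ^ (-((n : ℝ) / 2)) : ℝ) * besselRadial n (n / 2) (α ^ 2) x := by
  have hr : 0 < ‖x‖ := norm_pos_iff.2 hx
  set r := ‖x‖ with hrdef
  set ν : ℝ := (n : ℝ) / 2 - 1 with hν
  have hG := Real.Gamma_pos_of_pos (by positivity : (0 : ℝ) < n / 2)
  have hw := sphereArea_mul_Gamma hn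
  have hpi : (0 : ℝ) < Real.pi ^ ((n : ℝ) / 2) := by positivity
  have hν1 : ν + 1 = n / 2 := by rw [hν]; ring
  have e0 : ((n : ℂ) / 2 - 1) = (ν : ℂ) := by rw [hν]; push_cast; rfl
  have e1 : 1 - (n : ℝ) / 2 = -ν := by rw [hν]; ring
  have e2 : (α / 2) ^ ν * r ^ (-ν) * (r / (2 * α)) ^ ν = 4 * 4 ^ (-((n : ℝ) / 2)) := by
    have h4 : (4 : ℝ) ^ (-((n : ℝ) / 2)) = 4 ^ (-ν) * 4⁻¹ := by
      rw [← Real.rpow_neg_one, ← Real.rpow_add (by norm_num), ← hν1]; congr 1; ring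
    rw [h4, Real.rpow_neg hr.le, Real.rpow_neg (by norm_num), ← Real.inv_rpow hr.le,
      ← Real.inv_rpow (by norm_num), ← Real.mul_rpow (by positivity) (by positivity),
      ← Real.mul_rpow (by positivity) (by positivity)]
    have : α / 2 * r⁻¹ * (r / (2 * α)) = 4⁻¹ := by field_simp; norm_num
    rw [this]
    ring
  rw [euclideanKG, e0, ← hν, I_mul_div_two_cpow hα, ← hrdef, e1, hankelOne_I_mul hα hr, hν1,
    besselRadial, ← hrdef]
  set B := besselInt (n / 2) (r ^ 2 / 4) (α ^ 2)
  have e3 : Complex.exp (ν * Real.pi * Complex.I / 2) *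
      Complex.exp (-(ν * Real.pi * Complex.I / 2)) = 1 := by rw [← Complex.exp_add]; simp
  have e4 : (2 * sphereArea n * Real.Gamma ((n : ℝ) / 2) : ℂ) =
      4 * (Real.pi ^ ((n : ℝ) / 2) : ℝ) := by
    rw [mul_assoc, ← Complex.ofReal_mul, hw]; push_cast; ring
  have e5 : ((4 * Real.pi) ^ (-((n : ℝ) / 2)) : ℝ) =
      4 ^ (-((n : ℝ) / 2)) / Real.pi ^ ((n : ℝ) / 2) := by
    rw [Real.mul_rpow (by norm_num) Real.pi_pos.le, Real.rpow_neg Real.pi_pos.le, ← div_eq_mul_inv]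
  have hpiC : ((Real.pi ^ ((n : ℝ) / 2) : ℝ) : ℂ) ≠ 0 := Complex.ofReal_ne_zero.2 hpi.ne'
  have hpi0 : (Real.pi : ℂ) ≠ 0 := Complex.ofReal_ne_zero.2 Real.pi_ne_zero
  rw [e4, e5]
  calc _ = -((Complex.I * Real.pi) / (Real.pi * Complex.I)) *
        (1 / (4 * (Real.pi ^ ((n : ℝ) / 2) : ℝ))) *
        (Complex.exp (ν * Real.pi * Complex.I / 2) *
          Complex.exp (-(ν * Real.pi * Complex.I / 2))) *
        ((((α / 2) ^ ν * r ^ (-ν) * (r / (2 * α)) ^ ν : ℝ) : ℂ) * B) := by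
        push_cast
        ring
    _ = _ := by
        rw [e3, e2, mul_comm Complex.I, div_self (mul_ne_zero hpi0 Complex.I_ne_zero)]
        push_cast
        field_simp

end HankelBessel

/-! ### Gaussian means and the heat equation -/

section Gauss

variable {n : ℕ}

/-- The unnormalized heat kernel `exp (-‖y‖² / 4)` at time `1`. -/
noncomputable def gauss (y : EuclideanSpace ℝ (Fin n)) : ℝ := Real.exp (-(‖y‖ ^ 2 / 4))

theorem gauss_pos (y : EuclideanSpace ℝ (Fin n)) : 0 < gauss y := Real.exp_pos _

theorem continuous_gauss : Continuous (gauss : EuclideanSpace ℝ (Fin n) → ℝ) := by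
  unfold gauss; fun_prop

theorem integrable_exp_neg_mul_norm_sq {b : ℝ} (hb : 0 < b) :
    Integrable (fun y : EuclideanSpace ℝ (Fin n) => Real.exp (-b * ‖y‖ ^ 2)) := by
  have h := GaussianFourier.integrable_cexp_neg_mul_sq_norm_add (b := b)
    (V := EuclideanSpace ℝ (Fin n)) (by simpa using hb) 0 0
  refine h.norm.congr (Eventually.of_forall fun y => ?_)
  simp [Complex.norm_exp, ← Complex.ofReal_pow]

theorem integrable_gauss : Integrable (gauss : EuclideanSpace ℝ (Fin n) → ℝ) := by
  refine (integrable_exp_neg_mul_norm_sq (b := 1 / 4) (by norm_num)).congr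
    (Eventually.of_forall fun y => ?_)
  simp only [gauss]
  congr 1
  ring

theorem integral_gauss :
    ∫ y : EuclideanSpace ℝ (Fin n), gauss y = (4 * Real.pi) ^ ((n : ℝ) / 2) := by
  have h := GaussianFourier.integral_rexp_neg_mul_sq_norm (V := EuclideanSpace ℝ (Fin n))
    (b := 1 / 4) (by norm_num)
  rw [finrank_euclideanSpace, Fintype.card_fin] at h
  rw [show (4 * Real.pi) = Real.pi / (1 / 4) by ring, ← h]
  congr 1
  ext y
  simp only [gauss]
  congr 1
  ring

theorem integrable_norm_mul_gauss :
    Integrable (fun y : EuclideanSpace ℝ (Fin n) => ‖y‖ * gauss y) := by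
  refine ((integrable_exp_neg_mul_norm_sq (b := 1 / 8) (by norm_num)).const_mul 2).mono'
    (continuous_norm.mul continuous_gauss).aestronglyMeasurable (Eventually.of_forall fun y => ?_)
  rw [Real.norm_of_nonneg (mul_nonneg (norm_nonneg y) (gauss_pos y).le)]
  have h1 : ‖y‖ ≤ 2 * Real.exp (‖y‖ ^ 2 / 8) := by
    nlinarith [Real.add_one_le_exp (‖y‖ ^ 2 / 8), sq_nonneg (‖y‖ / 2 - 1)]
  calc ‖y‖ * gauss y ≤ 2 * Real.exp (‖y‖ ^ 2 / 8) * Real.exp (-(‖y‖ ^ 2 / 4)) := by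
        unfold gauss; gcongr
    _ = _ := by rw [mul_assoc, ← Real.exp_add]; congr 2; ring

/-- The solution `∫ exp (-‖y‖² / 4) h (√s y) dy` at `0` of the heat equation with initial value `h`,
up to the factor `(4 π)^(n/2)`. It is constant in `s ≤ 0`. -/
noncomputable def gaussMean (h : EuclideanSpace ℝ (Fin n) → ℂ) (s : ℝ) : ℂ :=
  ∫ y, (gauss y : ℂ) * h (√s • y)

variable {h : EuclideanSpace ℝ (Fin n) → ℂ} {B : ℝ}

theorem integrable_gauss_mul (hc : Continuous h) (hB : ∀ x, ‖h x‖ ≤ B) :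
    Integrable fun y : EuclideanSpace ℝ (Fin n) => (gauss y : ℂ) * h y :=
  integrable_gauss.ofReal.mul_bdd hc.aestronglyMeasurable (Eventually.of_forall hB)

theorem continuous_gaussMean (hc : Continuous h) (hB : ∀ x, ‖h x‖ ≤ B) :
    Continuous (gaussMean h) := by
  refine continuous_of_dominated (bound := fun y => gauss y * B) (fun s => ?_) (fun s => ?_)
    (integrable_gauss.mul_const B) ?_
  · exact ((Complex.continuous_ofReal.comp continuous_gauss).mul
      (hc.comp (continuous_const_smul _))).aestronglyMeasurable
  · refine Eventually.of_forall fun y => ?_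
    rw [norm_mul, Complex.norm_real, Real.norm_of_nonneg (gauss_pos y).le]
    exact mul_le_mul_of_nonneg_left (hB _) (gauss_pos y).le
  · exact Eventually.of_forall fun y => continuous_const.mul
      (hc.comp (Real.continuous_sqrt.smul continuous_const))

theorem norm_gaussMean_le (hB : ∀ x, ‖h x‖ ≤ B) (s : ℝ) :
    ‖gaussMean h s‖ ≤ ∫ y : EuclideanSpace ℝ (Fin n), gauss y * B := by
  refine norm_integral_le_of_norm_le (integrable_gauss.mul_const B)
    (Eventually.of_forall fun y => ?_)
  rw [norm_mul, Complex.norm_real, Real.norm_of_nonneg (gauss_pos y).le]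
  exact mul_le_mul_of_nonneg_left (hB _) (gauss_pos y).le

theorem gaussMean_zero (h : EuclideanSpace ℝ (Fin n) → ℂ) :
    gaussMean h 0 = ((4 * Real.pi) ^ ((n : ℝ) / 2) : ℝ) * h 0 := by
  simp only [gaussMean, Real.sqrt_zero, zero_smul]
  rw [integral_mul_const, integral_complex_ofReal, integral_gauss]

theorem integral_heatKernel_mul (h : EuclideanSpace ℝ (Fin n) → ℂ) {s : ℝ} (hs : 0 < s) :
    ∫ x, ((s ^ (-((n : ℝ) / 2)) * Real.exp (-(‖x‖ ^ 2 / 4 / s)) : ℝ) : ℂ) * h x =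
      gaussMean h s := by
  have hs' : 0 < √s := Real.sqrt_pos.2 hs
  have key := Measure.integral_comp_smul (volume : Measure (EuclideanSpace ℝ (Fin n)))
    (fun x => ((Real.exp (-(‖x‖ ^ 2 / 4 / s)) : ℝ) : ℂ) * h x) (√s)
  rw [finrank_euclideanSpace, Fintype.card_fin, abs_of_pos (by positivity)] at key
  have e1 : (√s ^ n)⁻¹ = s ^ (-((n : ℝ) / 2)) := by
    rw [Real.sqrt_eq_rpow, ← Real.rpow_natCast, ← Real.rpow_mul hs.le, ← Real.rpow_neg hs.le]
    congr 1
    ring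
  have e2 : ∀ y : EuclideanSpace ℝ (Fin n), ‖√s • y‖ ^ 2 / 4 / s = ‖y‖ ^ 2 / 4 := fun y => by
    rw [norm_smul, Real.norm_of_nonneg hs'.le, mul_pow, Real.sq_sqrt hs.le]
    field_simp
  simp only [e2, e1] at key
  rw [gaussMean]
  simp only [gauss]
  rw [key, ← integral_smul]
  congr 1
  ext x
  rw [Complex.real_smul]
  push_cast
  ring

theorem norm_apply_single_le {F : Type*} [NormedAddCommGroup F] [NormedSpace ℝ F]
    (L : EuclideanSpace ℝ (Fin n) →L[ℝ] F) (i : Fin n) :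
    ‖L (EuclideanSpace.single i 1)‖ ≤ ‖L‖ := by
  simpa using L.le_opNorm (EuclideanSpace.single i 1)

theorem laplacian_eq_sum_fderiv_fderiv (g : EuclideanSpace ℝ (Fin n) → ℂ)
    (x : EuclideanSpace ℝ (Fin n)) :
    (Δ g) x = ∑ i, fderiv ℝ (fderiv ℝ g) x (EuclideanSpace.single i 1)
      (EuclideanSpace.single i 1) := by
  rw [InnerProductSpace.laplacian_eq_iteratedFDeriv_orthonormalBasis g
    (EuclideanSpace.basisFun (Fin n) ℝ)]
  simp [iteratedFDeriv_two_apply]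

/-- A function with bounded continuous derivatives up to order two. -/
structure BoundedC2 (g : EuclideanSpace ℝ (Fin n) → ℂ) : Prop where
  contDiff : ContDiff ℝ 2 g
  bound : ∃ B, ∀ x, ‖g x‖ ≤ B
  bound_fderiv : ∃ B, ∀ x, ‖fderiv ℝ g x‖ ≤ B
  bound_fderiv_fderiv : ∃ B, ∀ x, ‖fderiv ℝ (fderiv ℝ g) x‖ ≤ B

namespace BoundedC2

variable {g : EuclideanSpace ℝ (Fin n) → ℂ} 

theorem contDiff_fderiv (hg : BoundedC2 g) : ContDiff ℝ 1 (fderiv ℝ g) :=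
  hg.contDiff.fderiv_right (by norm_num)

theorem continuous_fderiv_fderiv (hg : BoundedC2 g) : Continuous (fderiv ℝ (fderiv ℝ g)) :=
  hg.contDiff_fderiv.continuous_fderiv (by norm_num)

theorem differentiable (hg : BoundedC2 g) : Differentiable ℝ g :=
  hg.contDiff.differentiable (by norm_num)

theorem differentiable_fderiv (hg : BoundedC2 g) : Differentiable ℝ (fderiv ℝ g) :=
  hg.contDiff_fderiv.differentiable (by norm_num)



theorem continuous_laplacian (hg : BoundedC2 g) : Continuous (Δ g) := by
  have h := hg.continuous_fderiv_fderiv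
  rw [funext (laplacian_eq_sum_fderiv_fderiv g)]
  fun_prop

theorem bound_laplacian (hg : BoundedC2 g) : ∃ B, ∀ x, ‖(Δ g) x‖ ≤ B := by
  obtain ⟨B, hB⟩ := hg.bound_fderiv_fderiv
  refine ⟨∑ _i : Fin n, B, fun x => ?_⟩
  rw [laplacian_eq_sum_fderiv_fderiv]
  refine (norm_sum_le _ _).trans (Finset.sum_le_sum fun i _ => ?_)
  have h1 := norm_apply_single_le (fderiv ℝ (fderiv ℝ g) x (EuclideanSpace.single i 1)) i
  have h2 := norm_apply_single_le (fderiv ℝ (fderiv ℝ g) x) i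
  exact h1.trans (h2.trans (hB x))

end BoundedC2

theorem hasFDerivAt_gauss (y : EuclideanSpace ℝ (Fin n)) :
    HasFDerivAt (fun y : EuclideanSpace ℝ (Fin n) => (gauss y : ℂ))
      (ofPartials fun i => -(1 / 2) * (y i * gauss y)) y := by
  have h1 : HasFDerivAt (fun y : EuclideanSpace ℝ (Fin n) => -(‖y‖ ^ 2 / 4))
      ((-4⁻¹ : ℝ) • (2 • innerSL ℝ y)) y := by
    refine (((hasStrictFDerivAt_norm_sq y).hasFDerivAt.const_mul (-4⁻¹ : ℝ)).congr_of_eventuallyEq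
      (Eventually.of_forall fun y => ?_))
    ring
  refine (Complex.ofRealCLM.hasFDerivAt.comp y h1.exp).congr_fderiv ?_
  ext v
  simp only [gauss, ofPartials_apply, ContinuousLinearMap.comp_apply, Complex.ofRealCLM_apply,
    smul_apply, innerSL_apply_apply, PiLp.inner_apply, RCLike.inner_apply, conj_trivial,
    Complex.real_smul, smul_eq_mul]
  push_cast
  rw [nsmul_eq_mul, Finset.mul_sum, Finset.mul_sum, Finset.mul_sum]
  refine Finset.sum_congr rfl fun i _ => ?_
  push_cast
  ring

/-- Gaussian integration by parts. -/
theorem integral_coord_mul_gauss_mul {f : EuclideanSpace ℝ (Fin n) → ℂ} (hf : ContDiff ℝ 1 f)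
    {B B' : ℝ} (hB : ∀ x, ‖f x‖ ≤ B) (hB' : ∀ x, ‖fderiv ℝ f x‖ ≤ B') (i : Fin n) :
    Integrable (fun y => (y i : ℂ) * gauss y * f y) ∧
    ∫ y, (1 / 2 : ℂ) * (y i * gauss y * f y) =
      ∫ y, (gauss y : ℂ) * fderiv ℝ f y (EuclideanSpace.single i 1) := by
  have hcoord : Continuous fun y : EuclideanSpace ℝ (Fin n) => (y i : ℂ) := by fun_prop
  have hgc : Continuous fun y : EuclideanSpace ℝ (Fin n) => (gauss y : ℂ) :=
    Complex.continuous_ofReal.comp continuous_gauss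
  have i1 : Integrable (fun y : EuclideanSpace ℝ (Fin n) => (y i : ℂ) * gauss y * f y) := by
    refine Integrable.mul_bdd (c := B) ?_ hf.continuous.aestronglyMeasurable
      (Eventually.of_forall hB)
    refine integrable_norm_mul_gauss.mono' (hcoord.mul hgc).aestronglyMeasurable
      (Eventually.of_forall fun y => ?_)
    rw [norm_mul, Complex.norm_real, Complex.norm_real, Real.norm_of_nonneg (gauss_pos y).le]
    exact mul_le_mul_of_nonneg_right (PiLp.norm_apply_le y i) (gauss_pos y).le
  refine ⟨i1, ?_⟩
  have e1 : ∀ y : EuclideanSpace ℝ (Fin n), fderiv ℝ (fun y : EuclideanSpace ℝ (Fin n) =>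
      (gauss y : ℂ)) y (EuclideanSpace.single i 1) = -(1 / 2) * (y i * gauss y) := fun y => by
    rw [(hasFDerivAt_gauss y).fderiv, ofPartials_single]
  have hdc := hf.continuous_fderiv (by norm_num)
  have key := integral_mul_fderiv_eq_neg_fderiv_mul_of_integrable (𝕜 := ℂ)
    (μ := (volume : Measure (EuclideanSpace ℝ (Fin n))))
    (f := fun y => (gauss y : ℂ)) (g := f) (v := EuclideanSpace.single i 1) ?_ ?_ ?_
    (fun y _ => (hasFDerivAt_gauss y).differentiableAt)
    (fun y _ => (hf.differentiable (by norm_num)).differentiableAt)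
  · rw [key, ← integral_neg]
    congr 1
    ext y
    rw [e1]
    ring
  · simp only [e1]
    refine (i1.const_mul (-(1 / 2) : ℂ)).congr (Eventually.of_forall fun y => ?_)
    ring
  · refine integrable_gauss_mul (h := fun y => fderiv ℝ f y (EuclideanSpace.single i 1)) (B := B')
      (by fun_prop) fun x => ?_
    have h := norm_apply_single_le (fderiv ℝ f x) i
    exact h.trans (hB' x)
  · exact integrable_gauss_mul hf.continuous hB

/-- Gaussian means solve the heat equation. -/
theorem BoundedC2.hasDerivAt_gaussMean {g : EuclideanSpace ℝ (Fin n) → ℂ} (hg : BoundedC2 g)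
    {s : ℝ} (hs : 0 < s) : HasDerivAt (gaussMean g) (gaussMean (Δ g) s) s := by
  obtain ⟨B, hB⟩ := hg.bound
  obtain ⟨B', hB'⟩ := hg.bound_fderiv
  obtain ⟨B'', hB''⟩ := hg.bound_fderiv_fderiv
  have hgc : Continuous fun y : EuclideanSpace ℝ (Fin n) => (gauss y : ℂ) :=
    Complex.continuous_ofReal.comp continuous_gauss
  have hfc := hg.contDiff_fderiv.continuous
  have hB0 : 0 ≤ B' := (norm_nonneg _).trans (hB' 0)
  have key := hasDerivAt_integral_of_dominated_loc_of_deriv_le (𝕜 := ℝ)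
    (μ := (volume : Measure (EuclideanSpace ℝ (Fin n))))
    (F := fun s y => (gauss y : ℂ) * g (√s • y))
    (F' := fun s y => (gauss y : ℂ) * fderiv ℝ g (√s • y) ((1 / (2 * √s)) • y))
    (bound := fun y => B' * (1 / (2 * √(s / 2))) * (‖y‖ * gauss y))
    (x₀ := s) (s := Ioi (s / 2)) (Ioi_mem_nhds (by linarith)) ?_ ?_ ?_ ?_ ?_ ?_
  · refine key.2.congr_deriv ?_
    have hs' : 0 < √s := Real.sqrt_pos.2 hs
    -- With `f i y = s^(-1/2) ∂_i g(√s y)` the integrand is `∑ (y_i / 2) exp (-‖y‖² / 4) f i y`,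
    -- and `∂_i (f i) = (∂_i ∂_i g)(√s y)`, so that one integration by parts yields `Δ g`.
    set f : Fin n → EuclideanSpace ℝ (Fin n) → ℂ := fun i y =>
      ((1 / √s : ℝ) : ℂ) * fderiv ℝ g (√s • y) (EuclideanSpace.single i 1) with hf
    have hfd : ∀ i y, HasFDerivAt (f i)
        ((ContinuousLinearMap.apply ℝ ℂ (EuclideanSpace.single i 1)).comp
          (fderiv ℝ (fderiv ℝ g) (√s • y))) y := by
      intro i y
      have h1 : HasFDerivAt (fun y : EuclideanSpace ℝ (Fin n) => √s • y)
          (√s • ContinuousLinearMap.id ℝ (EuclideanSpace ℝ (Fin n))) y :=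
        (√s • ContinuousLinearMap.id ℝ (EuclideanSpace ℝ (Fin n))).hasFDerivAt
      have h2 := ((ContinuousLinearMap.apply ℝ ℂ (EuclideanSpace.single i 1)).hasFDerivAt.comp y
        ((hg.differentiable_fderiv (√s • y)).hasFDerivAt.comp y h1)).const_mul
          ((1 / √s : ℝ) : ℂ)
      refine h2.congr_fderiv ?_
      ext v
      have : ((√s : ℝ) : ℂ) ≠ 0 := Complex.ofReal_ne_zero.2 hs'.ne'
      simp only [smul_apply, ContinuousLinearMap.comp_apply, ContinuousLinearMap.id_apply,
        map_smul, ContinuousLinearMap.apply_apply, Complex.real_smul, smul_eq_mul]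
      push_cast
      field_simp
    have hfC : ∀ i, ContDiff ℝ 1 (f i) := fun i =>
      contDiff_const.mul ((hg.contDiff_fderiv.comp (contDiff_const_smul _)).clm_apply
        contDiff_const)
    have hfB : ∀ i y, ‖f i y‖ ≤ 1 / √s * B' := fun i y => by
      have h := norm_apply_single_le (fderiv ℝ g (√s • y)) i
      rw [norm_mul, Complex.norm_real, Real.norm_of_nonneg (by positivity)]
      exact mul_le_mul_of_nonneg_left (h.trans (hB' _)) (by positivity)
    have hfB' : ∀ i y, ‖fderiv ℝ (f i) y‖ ≤ B'' := fun i y => by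
      rw [(hfd i y).fderiv]
      refine ContinuousLinearMap.opNorm_le_bound _
        ((norm_nonneg (fderiv ℝ (fderiv ℝ g) 0)).trans (hB'' 0)) fun v => ?_
      have h := norm_apply_single_le (fderiv ℝ (fderiv ℝ g) (√s • y) v) i
      exact h.trans (((fderiv ℝ (fderiv ℝ g) (√s • y)).le_opNorm v).trans
        (mul_le_mul_of_nonneg_right (hB'' _) (norm_nonneg v)))
    have hibp := fun i => integral_coord_mul_gauss_mul (hfC i) (hfB i) (hfB' i) i
    have e1 : ∀ y : EuclideanSpace ℝ (Fin n),
        (gauss y : ℂ) * fderiv ℝ g (√s • y) ((1 / (2 * √s)) • y) =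
          ∑ i, (1 / 2 : ℂ) * (y i * gauss y * f i y) := fun y => by
      rw [eq_ofPartials (fderiv ℝ g (√s • y)), ofPartials_apply, Finset.mul_sum]
      refine Finset.sum_congr rfl fun i _ => ?_
      simp only [hf, PiLp.smul_apply, smul_eq_mul, Complex.real_smul]
      push_cast
      ring
    have e2 : ∀ y : EuclideanSpace ℝ (Fin n), (gauss y : ℂ) * (Δ g) (√s • y) =
        ∑ i, (gauss y : ℂ) * fderiv ℝ (f i) y (EuclideanSpace.single i 1) := fun y => by
      rw [laplacian_eq_sum_fderiv_fderiv, Finset.mul_sum]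
      simp only [(hfd _ y).fderiv, ContinuousLinearMap.comp_apply,
        ContinuousLinearMap.apply_apply]
    simp only [gaussMean, e1, e2]
    rw [integral_finsetSum _ fun i _ => (hibp i).1.const_mul _, integral_finsetSum]
    · exact Finset.sum_congr rfl fun i _ => (hibp i).2
    · intro i _
      have hc := (hfC i).continuous_fderiv (by norm_num)
      refine integrable_gauss_mul (h := fun y => fderiv ℝ (f i) y (EuclideanSpace.single i 1))
        (B := B'') (by fun_prop) fun x => ?_
      have h := norm_apply_single_le (fderiv ℝ (f i) x) i
      exact h.trans (hfB' i x)
  · exact Eventually.of_forall fun s => (hgc.mul (hg.contDiff.continuous.comp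
      (continuous_const_smul _))).aestronglyMeasurable
  · exact integrable_gauss_mul (h := fun y => g (√s • y)) (hg.contDiff.continuous.comp
      (continuous_const_smul _)) fun y => hB _
  · have : Continuous fun y : EuclideanSpace ℝ (Fin n) =>
        (gauss y : ℂ) * fderiv ℝ g (√s • y) ((1 / (2 * √s)) • y) := by fun_prop
    exact this.aestronglyMeasurable
  · refine Eventually.of_forall fun y t ht => ?_
    have ht : s / 2 < t := ht
    have ht0 : 0 < √(s / 2) := Real.sqrt_pos.2 (by linarith)
    have hle : √(s / 2) ≤ √t := Real.sqrt_le_sqrt ht.le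
    have ht1 : 0 < √t := ht0.trans_le hle
    rw [norm_mul, Complex.norm_real, Real.norm_of_nonneg (gauss_pos y).le]
    have h1 := (fderiv ℝ g (√t • y)).le_opNorm ((1 / (2 * √t)) • y)
    rw [norm_smul, Real.norm_of_nonneg (by positivity)] at h1
    have h2 : ‖fderiv ℝ g (√t • y)‖ * (1 / (2 * √t) * ‖y‖) ≤
        B' * (1 / (2 * √(s / 2)) * ‖y‖) := by
      gcongr
      exact hB' _
    calc _ ≤ gauss y * (B' * (1 / (2 * √(s / 2)) * ‖y‖)) :=
          mul_le_mul_of_nonneg_left (h1.trans h2) (gauss_pos y).le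
      _ = _ := by ring
  · exact integrable_norm_mul_gauss.const_mul _
  · refine Eventually.of_forall fun y t ht => ?_
    have ht0 : 0 < t := lt_trans (by linarith) (show s / 2 < t from ht)
    have h1 : HasDerivAt (fun t : ℝ => √t • y) ((1 / (2 * √t)) • y) t :=
      (Real.hasDerivAt_sqrt ht0.ne').smul_const y
    exact ((hg.differentiable (√t • y)).hasFDerivAt.comp_hasDerivAt t h1).const_mul _

/-- The Laplace transform in `s` of the heat equation. -/
theorem BoundedC2.integral_exp_mul_gaussMean {g : EuclideanSpace ℝ (Fin n) → ℂ}
    (hg : BoundedC2 g) {c : ℝ} (hc : 0 < c) :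
    ∫ s in Ioi (0 : ℝ), (Real.exp (-c * s) : ℂ) * (gaussMean (Δ g) s - c * gaussMean g s) =
      -(((4 * Real.pi) ^ ((n : ℝ) / 2) : ℝ) * g 0) := by
  obtain ⟨B, hB⟩ := hg.bound
  obtain ⟨D, hD⟩ := hg.bound_laplacian
  have c1 := continuous_gaussMean hg.contDiff.continuous hB
  have c2 := continuous_gaussMean hg.continuous_laplacian hD
  have c3 : Continuous fun s : ℝ => (Real.exp (-c * s) : ℂ) := by fun_prop
  have hint : IntegrableOn (fun s : ℝ => (Real.exp (-c * s) : ℂ)) (Ioi 0) :=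
    (exp_neg_integrableOn_Ioi 0 hc).ofReal
  rw [integral_Ioi_of_hasDerivAt_of_tendsto
    (f := fun s : ℝ => (Real.exp (-c * s) : ℂ) * gaussMean g s) (m := 0)
    (c3.mul c1).continuousWithinAt ?_ ?_ ?_]
  · simp [gaussMean_zero]
  · intro s hs
    have h1 : HasDerivAt (fun s : ℝ => (Real.exp (-c * s) : ℂ))
        ((Real.exp (-c * s) * (-c) : ℝ) : ℂ) s := by
      have := ((hasDerivAt_id s).const_mul (-c)).exp.ofReal_comp
      simpa using this
    refine (h1.mul (hg.hasDerivAt_gaussMean hs)).congr_deriv ?_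
    push_cast
    ring
  · refine hint.mul_bdd (c := (∫ y : EuclideanSpace ℝ (Fin n), gauss y * D) +
      c * ∫ y : EuclideanSpace ℝ (Fin n), gauss y * B)
      (c2.sub (continuous_const.mul c1)).aestronglyMeasurable (Eventually.of_forall fun s => ?_)
    refine (norm_sub_le _ _).trans (add_le_add (norm_gaussMean_le hD s) ?_)
    rw [norm_mul, Complex.norm_real, Real.norm_of_nonneg hc.le]
    exact mul_le_mul_of_nonneg_left (norm_gaussMean_le hB s) hc.le
  · have hlim : Tendsto (fun s : ℝ => Real.exp (-c * s) *
        ∫ y : EuclideanSpace ℝ (Fin n), gauss y * B) atTop (𝓝 0) := by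
      have h1 : Tendsto (fun s : ℝ => Real.exp (-c * s)) atTop (𝓝 0) :=
        Real.tendsto_exp_atBot.comp (tendsto_id.const_mul_atTop_of_neg (by linarith))
      simpa using h1.mul_const (∫ y : EuclideanSpace ℝ (Fin n), gauss y * B)
    refine squeeze_zero_norm (fun s => ?_) hlim
    rw [norm_mul, Complex.norm_real, Real.norm_of_nonneg (Real.exp_pos _).le]
    exact mul_le_mul_of_nonneg_left (norm_gaussMean_le hB s) (Real.exp_pos _).le

end Gauss

/-! ### The distributional identity in Euclidean space -/

section Euclidean

variable {n : ℕ}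

/-- The integrand of `besselRadial` as a function of both variables. -/
noncomputable def heatLaplace (n : ℕ) (c : ℝ) (p : EuclideanSpace ℝ (Fin n) × ℝ) : ℝ :=
  p.2 ^ (-((n : ℝ) / 2)) * Real.exp (-(‖p.1‖ ^ 2 / 4 / p.2) - c * p.2)

theorem heatLaplace_eq (c : ℝ) (x : EuclideanSpace ℝ (Fin n)) (s : ℝ) :
    heatLaplace n c (x, s) =
      Real.exp (-c * s) * (s ^ (-((n : ℝ) / 2)) * Real.exp (-(‖x‖ ^ 2 / 4 / s))) := by
  rw [heatLaplace, sub_eq_add_neg, Real.exp_add, ← neg_mul]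
  ring

theorem integrable_heatLaplace {c : ℝ} (hc : 0 < c) :
    Integrable (heatLaplace n c) (volume.prod (volume.restrict (Ioi 0))) := by
  have hmeas : Measurable (heatLaplace n c) := by unfold heatLaplace; fun_prop
  have hval : ∀ s : ℝ, 0 < s → ∫ x, ‖heatLaplace n c (x, s)‖ =
      Real.exp (-c * s) * (4 * Real.pi) ^ ((n : ℝ) / 2) := fun s hs => by
    have h1 := integral_heatKernel_mul (n := n) (fun _ => 1) hs
    simp only [mul_one, gaussMean] at h1
    rw [integral_complex_ofReal, integral_complex_ofReal, integral_gauss] at h1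
    rw [← Complex.ofReal_inj.1 h1, ← integral_const_mul]
    refine integral_congr_ae (Eventually.of_forall fun x => ?_)
    dsimp only
    rw [heatLaplace_eq, Real.norm_of_nonneg (by positivity)]
  rw [integrable_prod_iff' hmeas.aestronglyMeasurable]
  constructor
  · filter_upwards [ae_restrict_mem measurableSet_Ioi] with s hs
    have hs : 0 < s := hs
    have h1 := integrable_exp_neg_mul_norm_sq (n := n) (b := 1 / (4 * s)) (by positivity)
    refine (h1.const_mul (Real.exp (-c * s) * s ^ (-((n : ℝ) / 2)))).congr
      (Eventually.of_forall fun x => ?_)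
    dsimp only
    rw [heatLaplace_eq, mul_assoc]
    congr 3
    field_simp
  · refine ((exp_neg_integrableOn_Ioi 0 hc).mul_const ((4 * Real.pi) ^ ((n : ℝ) / 2))).congr ?_
    filter_upwards [ae_restrict_mem measurableSet_Ioi] with s hs
    exact (hval s hs).symm

theorem besselRadial_eq_integral (c : ℝ) (x : EuclideanSpace ℝ (Fin n)) :
    besselRadial n (n / 2) c x = ∫ s in Ioi (0 : ℝ), (heatLaplace n c (x, s) : ℂ) := by
  rw [integral_complex_ofReal]
  rfl

theorem integrable_besselRadial {c : ℝ} (hc : 0 < c) :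
    Integrable (besselRadial n (n / 2) c) := by
  rw [funext (besselRadial_eq_integral c)]
  exact ((integrable_heatLaplace hc).ofReal (𝕜 := ℂ)).integral_prod_left

theorem integral_besselRadial_mul {c : ℝ} (hc : 0 < c) {h : EuclideanSpace ℝ (Fin n) → ℂ}
    (hcont : Continuous h) {B : ℝ} (hB : ∀ x, ‖h x‖ ≤ B) :
    ∫ x, besselRadial n (n / 2) c x * h x =
      ∫ s in Ioi (0 : ℝ), (Real.exp (-c * s) : ℂ) * gaussMean h s := by
  have hint : Integrable (fun p : EuclideanSpace ℝ (Fin n) × ℝ =>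
      (heatLaplace n c p : ℂ) * h p.1) (volume.prod (volume.restrict (Ioi 0))) :=
    (integrable_heatLaplace hc).ofReal.mul_bdd (hcont.comp continuous_fst).aestronglyMeasurable
      (Eventually.of_forall fun p => hB p.1)
  have hswap := integral_integral_swap (f := fun x s => (heatLaplace n c (x, s) : ℂ) * h x) hint
  simp only [integral_mul_const, ← besselRadial_eq_integral] at hswap
  rw [hswap]
  refine setIntegral_congr_fun measurableSet_Ioi fun s hs => ?_
  rw [← integral_heatKernel_mul h hs, ← integral_const_mul]
  congr 1
  ext x
  rw [heatLaplace_eq]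
  push_cast
  ring

theorem integrable_euclideanKG (hn : 0 < n) {α : ℝ} (hα : 0 < α) :
    Integrable (euclideanKG n α) := by
  have : Nonempty (Fin n) := ⟨⟨0, hn⟩⟩
  refine ((integrable_besselRadial (n := n) (c := α ^ 2) (by positivity)).const_mul
    (-((4 * Real.pi) ^ (-((n : ℝ) / 2)) : ℝ) : ℂ)).congr ?_
  filter_upwards [compl_mem_ae_iff.2 (measure_singleton (0 : EuclideanSpace ℝ (Fin n)))] with x hx
  exact (euclideanKG_eq hn hα hx).symm

/-- `(Δ - α²) E_α = δ_0`, tested on functions with bounded derivatives up to order two. -/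
theorem integral_euclideanKG_mul_kleinGordon (hn : 0 < n) {α : ℝ} (hα : 0 < α)
    {g : EuclideanSpace ℝ (Fin n) → ℂ} (hg : BoundedC2 g) :
    ∫ x, euclideanKG n α x * kleinGordon α g x = g 0 := by
  have : Nonempty (Fin n) := ⟨⟨0, hn⟩⟩
  obtain ⟨B, hB⟩ := hg.bound
  obtain ⟨D, hD⟩ := hg.bound_laplacian
  have hc : (0 : ℝ) < α ^ 2 := by positivity
  have hgc := hg.contDiff.continuous
  have hBr := integrable_besselRadial (n := n) hc
  have hi1 : Integrable fun x => besselRadial n (n / 2) (α ^ 2) x * (Δ g) x :=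
    hBr.mul_bdd hg.continuous_laplacian.aestronglyMeasurable (Eventually.of_forall hD)
  have hi2 : Integrable fun x => besselRadial n (n / 2) (α ^ 2) x * g x :=
    hBr.mul_bdd hgc.aestronglyMeasurable (Eventually.of_forall hB)
  have hae : ∀ᵐ x : EuclideanSpace ℝ (Fin n), euclideanKG n α x * kleinGordon α g x =
      -((4 * Real.pi) ^ (-((n : ℝ) / 2)) : ℝ) * (besselRadial n (n / 2) (α ^ 2) x * (Δ g) x -
        (α ^ 2 : ℝ) * (besselRadial n (n / 2) (α ^ 2) x * g x)) := by
    filter_upwards [compl_mem_ae_iff.2 (measure_singleton (0 : EuclideanSpace ℝ (Fin n)))]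
      with x hx
    rw [euclideanKG_eq hn hα hx, kleinGordon]
    push_cast
    ring
  have hexp : IntegrableOn (fun s : ℝ => (Real.exp (-(α ^ 2) * s) : ℂ)) (Ioi 0) :=
    (exp_neg_integrableOn_Ioi 0 hc).ofReal
  have hj1 : IntegrableOn (fun s : ℝ => (Real.exp (-(α ^ 2) * s) : ℂ) * gaussMean (Δ g) s)
      (Ioi 0) := hexp.mul_bdd
    (continuous_gaussMean hg.continuous_laplacian hD).aestronglyMeasurable
    (Eventually.of_forall (norm_gaussMean_le hD))
  have hj2 : IntegrableOn (fun s : ℝ => (Real.exp (-(α ^ 2) * s) : ℂ) * gaussMean g s)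
      (Ioi 0) := hexp.mul_bdd (continuous_gaussMean hgc hB).aestronglyMeasurable
    (Eventually.of_forall (norm_gaussMean_le hB))
  have hlap := hg.integral_exp_mul_gaussMean hc
  have hsplit : ∀ s : ℝ, (Real.exp (-(α ^ 2) * s) : ℂ) *
      (gaussMean (Δ g) s - (α ^ 2 : ℝ) * gaussMean g s) =
      (Real.exp (-(α ^ 2) * s) : ℂ) * gaussMean (Δ g) s -
        (α ^ 2 : ℝ) * ((Real.exp (-(α ^ 2) * s) : ℂ) * gaussMean g s) := fun s => by ring
  simp only [hsplit] at hlap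
  rw [integral_sub hj1 (hj2.const_mul _), integral_const_mul] at hlap
  rw [integral_congr_ae hae, integral_const_mul, integral_sub hi1 (hi2.const_mul _),
    integral_const_mul, integral_besselRadial_mul hc hg.continuous_laplacian hD,
    integral_besselRadial_mul hc hgc hB, hlap]
  have h4 : (4 * Real.pi) ^ (-((n : ℝ) / 2)) * (4 * Real.pi) ^ ((n : ℝ) / 2) = 1 := by
    rw [← Real.rpow_add (by positivity)]; simp
  rw [neg_mul_neg, ← mul_assoc, ← Complex.ofReal_mul, h4, Complex.ofReal_one, one_mul]

end Euclidean

/-! ### Symmetries of the lattice and of the Möbius strip -/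

section Symmetries

variable {n k l : ℕ}

theorem scaleLast_apply_of_lt (hkn : k < n) (ε : ℝ) (x : EuclideanSpace ℝ (Fin n)) {i : Fin n}
    (hi : (i : ℕ) < k) : scaleLast ε x i = x i := by
  simp [scaleLast, show (i : ℕ) + 1 ≠ n by omega]

theorem scaleLast_one (x : EuclideanSpace ℝ (Fin n)) : scaleLast 1 x = x := by
  ext i; simp [scaleLast]

theorem scaleLast_zero (ε : ℝ) : scaleLast ε (0 : EuclideanSpace ℝ (Fin n)) = 0 := by
  ext i; simp [scaleLast]

theorem scaleLast_scaleLast (ε ε' : ℝ) (x : EuclideanSpace ℝ (Fin n)) :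
    scaleLast ε (scaleLast ε' x) = scaleLast (ε * ε') x := by
  ext i
  by_cases h : (i : ℕ) + 1 = n <;> simp [scaleLast, h, mul_assoc]

theorem scaleLast_add_latticeVec (hkn : k < n) (ε : ℝ) (x : EuclideanSpace ℝ (Fin n))
    (m : Fin k → ℤ) : scaleLast ε (x + latticeVec n m) = scaleLast ε x + latticeVec n m := by
  ext i
  by_cases h : (i : ℕ) + 1 = n
  · have : ¬ (i : ℕ) < k := by omega
    simp [scaleLast, latticeVec, h, this]
  · simp [scaleLast, h]

theorem scaleLast_apply_sq {ε : ℝ} (hε : ε * ε = 1) (x : EuclideanSpace ℝ (Fin n)) (i : Fin n) :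
    (scaleLast ε x i) ^ 2 = x i ^ 2 := by
  by_cases h : (i : ℕ) + 1 = n
  · simp only [scaleLast, h, if_true]
    linear_combination x i ^ 2 * hε
  · simp [scaleLast, h]

theorem norm_scaleLast {ε : ℝ} (hε : ε * ε = 1) (x : EuclideanSpace ℝ (Fin n)) :
    ‖scaleLast ε x‖ = ‖x‖ := by
  simp only [EuclideanSpace.norm_eq, Real.norm_eq_abs, sq_abs, scaleLast_apply_sq hε]

/-- For `ε = ±1`, the map `scaleLast ε` as a linear isometry. -/
noncomputable def scaleLastIsometry (n : ℕ) {ε : ℝ} (hε : ε * ε = 1) :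
    EuclideanSpace ℝ (Fin n) ≃ₗᵢ[ℝ] EuclideanSpace ℝ (Fin n) where
  toFun := scaleLast ε
  invFun := scaleLast ε
  map_add' x y := by
    ext i
    by_cases h : (i : ℕ) + 1 = n <;> simp [scaleLast, h, mul_add]
  map_smul' c x := by
    ext i
    by_cases h : (i : ℕ) + 1 = n <;> simp [scaleLast, h, mul_left_comm]
  left_inv x := by rw [scaleLast_scaleLast, hε, scaleLast_one]
  right_inv x := by rw [scaleLast_scaleLast, hε, scaleLast_one]
  norm_map' := norm_scaleLast hε

theorem latticeSgn_mul_self (m : Fin k → ℤ) : latticeSgn m * latticeSgn m = 1 := by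
  unfold latticeSgn; split_ifs <;> norm_num

theorem latticeSgn_two_smul (m : Fin k → ℤ) : latticeSgn (2 • m) = 1 := by
  unfold latticeSgn; rw [if_pos ⟨m, rfl⟩]

theorem latticeChar_zero : latticeChar l (0 : Fin k → ℤ) = 1 := by
  simp [latticeChar]

theorem latticeChar_add (m m' : Fin k → ℤ) :
    latticeChar l (m + m') = latticeChar l m * latticeChar l m' := by
  rw [latticeChar, latticeChar, latticeChar, ← zpow_add₀ (by norm_num), ← Finset.sum_add_distrib]
  congr 1
  exact Finset.sum_congr rfl fun i _ => by split_ifs <;> simp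

theorem latticeChar_mul_self (m : Fin k → ℤ) : latticeChar l m * latticeChar l m = 1 := by
  rw [latticeChar, ← mul_zpow]
  simp

theorem latticeChar_two_smul (m : Fin k → ℤ) : latticeChar l (2 • m) = 1 := by
  rw [two_smul, latticeChar_add, latticeChar_mul_self]

theorem latticeChar_neg (m : Fin k → ℤ) : latticeChar l (-m) = latticeChar l m := by
  have h : latticeChar l (-m) * latticeChar l m = 1 := by
    rw [← latticeChar_add, neg_add_cancel, latticeChar_zero]
  calc latticeChar l (-m) = latticeChar l (-m) * (latticeChar l m * latticeChar l m) := by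
        rw [latticeChar_mul_self, mul_one]
    _ = latticeChar l m := by rw [← mul_assoc, h, one_mul]

theorem norm_latticeChar (m : Fin k → ℤ) : ‖latticeChar l m‖ = 1 := by
  rw [latticeChar, norm_zpow, norm_neg, norm_one, one_zpow]

/-- The sum `∑_{i > k} x_i²`, a function that descends to the Möbius strip. -/
noncomputable def transverseSq (k : ℕ) (x : EuclideanSpace ℝ (Fin n)) : ℝ :=
  ∑ i : Fin n, if (i : ℕ) < k then 0 else x i ^ 2

theorem continuous_transverseSq :
    Continuous (transverseSq k : EuclideanSpace ℝ (Fin n) → ℝ) := by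
  refine continuous_finsetSum _ fun i _ => ?_
  split_ifs <;> fun_prop

theorem transverseSq_add_latticeVec (x : EuclideanSpace ℝ (Fin n)) (m : Fin k → ℤ) :
    transverseSq k (x + latticeVec n m) = transverseSq k x := by
  refine Finset.sum_congr rfl fun i _ => ?_
  by_cases h : (i : ℕ) < k <;> simp [latticeVec, h]

theorem transverseSq_scaleLast {ε : ℝ} (hε : ε * ε = 1) (x : EuclideanSpace ℝ (Fin n)) :
    transverseSq k (scaleLast ε x) = transverseSq k x := by
  simp only [transverseSq, scaleLast_apply_sq hε]

theorem mobiusProj_add_latticeVec (x : EuclideanSpace ℝ (Fin n)) (m : Fin k → ℤ) :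
    mobiusProj n k (x + latticeVec n m) = mobiusProj n k (scaleLast (latticeSgn m) x) :=
  Quot.sound ⟨m, x, rfl, rfl⟩

theorem mobiusProj_of_mem_latticeSet {x : EuclideanSpace ℝ (Fin n)} (hx : x ∈ latticeSet n k) :
    mobiusProj n k x = mobiusOrigin n k := by
  obtain ⟨m, rfl⟩ := hx
  have h := mobiusProj_add_latticeVec (n := n) 0 m
  rwa [zero_add, scaleLast_zero] at h

theorem preimage_compl_origin_subset :
    mobiusProj n k ⁻¹' {mobiusOrigin n k}ᶜ ⊆ (latticeSet n k)ᶜ := fun _ hx h =>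
  hx (mobiusProj_of_mem_latticeSet h)

/-- The transverse coordinates are bounded over a compact subset of the Möbius strip. -/
theorem exists_transverseSq_le {K : Set (Mobius n k)} (hK : IsCompact K) :
    ∃ C : ℝ, ∀ x : EuclideanSpace ℝ (Fin n), mobiusProj n k x ∈ K → transverseSq k x ≤ C := by
  let N : Mobius n k → ℝ := Quot.lift (transverseSq k) (by
    rintro _ _ ⟨m, x, rfl, rfl⟩
    rw [transverseSq_add_latticeVec, transverseSq_scaleLast (latticeSgn_mul_self m)])
  have hN : Continuous N := continuous_coinduced_dom.2 continuous_transverseSq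
  obtain ⟨C, hC⟩ := hK.exists_bound_of_continuousOn hN.continuousOn
  exact ⟨C, fun x hx => (le_abs_self _).trans (hC _ hx)⟩

end Symmetries

/-! ### The pinor bundle and lifts of its sections -/

section Pinor

variable {n k l : ℕ} {s : ℤˣ}

theorem PinorBundle.mk_add_latticeVec (x : EuclideanSpace ℝ (Fin n)) (m : Fin k → ℤ)
    (X : ComplexClifford n s) :
    (PinorBundle.mk (x + latticeVec n m) X : PinorBundle n k l s) =
      PinorBundle.mk (scaleLast (latticeSgn m) x) (latticeChar l m • X) :=
  Quot.sound ⟨m, x, X, rfl, rfl⟩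

/-- Equivalent points of `ℝⁿ × Cl_n(ℂ)` differ by a lattice translation, possibly a reflection,
and the value of the character at the translation. -/
theorem exists_of_eqvGen_pinorRel (hkn : k < n)
    {a b : EuclideanSpace ℝ (Fin n) × ComplexClifford n s}
    (h : Relation.EqvGen (PinorRel n k l s) a b) :
    ∃ (m : Fin k → ℤ) (ε : ℝ), ε * ε = 1 ∧ b.1 = scaleLast ε (a.1 + latticeVec n m) ∧
      b.2 = latticeChar l m • a.2 := by
  induction h with
  | rel a b h =>
    obtain ⟨m, x, X, rfl, rfl⟩ := h
    refine ⟨-m, latticeSgn m, latticeSgn_mul_self m, ?_, ?_⟩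
    · simp [latticeVec_neg]
    · simp [latticeChar_neg]
  | refl a =>
    refine ⟨0, 1, by norm_num, ?_, ?_⟩
    · rw [scaleLast_one, show latticeVec n (0 : Fin k → ℤ) = 0 by ext i; simp [latticeVec],
        add_zero]
    · rw [latticeChar_zero, one_smul]
  | symm a b _ ih =>
    obtain ⟨m, ε, hε, h1, h2⟩ := ih
    refine ⟨-m, ε, hε, ?_, ?_⟩
    · rw [h1, scaleLast_add_latticeVec hkn, scaleLast_add_latticeVec hkn,
        scaleLast_add_latticeVec hkn, scaleLast_scaleLast, hε, scaleLast_one, latticeVec_neg]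
      abel
    · rw [h2, smul_smul, latticeChar_neg, latticeChar_mul_self, one_smul]
  | trans a b c _ _ ih1 ih2 =>
    obtain ⟨m, ε, hε, h1, h2⟩ := ih1
    obtain ⟨m', ε', hε', h1', h2'⟩ := ih2
    refine ⟨m + m', ε' * ε, by rw [mul_mul_mul_comm, hε, hε', one_mul], ?_, ?_⟩
    · rw [h1', h1, ← scaleLast_add_latticeVec hkn, scaleLast_scaleLast, latticeVec_add, add_assoc]
    · rw [h2', h2, smul_smul, latticeChar_add, mul_comm]

/-- The fibre of the pinor bundle over `p_-(x)` is identified with `Cl_n(ℂ)` by `X ↦ [x, X]`. -/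
theorem PinorBundle.mk_injective (hkn : k < n) (x : EuclideanSpace ℝ (Fin n))
    {X Y : ComplexClifford n s}
    (h : (PinorBundle.mk x X : PinorBundle n k l s) = PinorBundle.mk x Y) : X = Y := by
  obtain ⟨m, ε, -, h1, h2⟩ := exists_of_eqvGen_pinorRel hkn (Quot.eqvGen_exact h)
  have hm : m = 0 := by
    ext i
    have hi : ((⟨i, i.2.trans hkn⟩ : Fin n) : ℕ) < k := i.2
    have h3 := congrArg (fun y : EuclideanSpace ℝ (Fin n) => y ⟨i, i.2.trans hkn⟩) h1
    simp only [scaleLast_apply_of_lt hkn _ _ hi, PiLp.add_apply,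
      latticeVec_apply_of_lt m hi] at h3
    simpa using h3
  rw [hm, latticeChar_zero, one_smul] at h2
  exact h2.symm

theorem PinorSection.IsLift.add_latticeVec (hkn : k < n) {φ : PinorSection n k l s univ}
    {g : EuclideanSpace ℝ (Fin n) → ComplexClifford n s} (h : φ.IsLift g)
    (x : EuclideanSpace ℝ (Fin n)) (m : Fin k → ℤ) :
    g (x + latticeVec n m) = latticeChar l m • g (scaleLast (latticeSgn m) x) := by
  have h1 := h (x + latticeVec n m) trivial
  have h2 := h (scaleLast (latticeSgn m) x) trivial
  have h3 : φ.toFun ⟨mobiusProj n k (x + latticeVec n m), trivial⟩ =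
      φ.toFun ⟨mobiusProj n k (scaleLast (latticeSgn m) x), trivial⟩ :=
    congrArg φ.toFun (Subtype.ext (mobiusProj_add_latticeVec x m))
  rw [h1, h2, PinorBundle.mk_add_latticeVec] at h3
  rw [← PinorBundle.mk_injective hkn _ h3, smul_smul, latticeChar_mul_self, one_smul]

/-- A function with the equivariance of a lift descends to a section over every subset. -/
theorem exists_pinorSection_isLift (U : Set (Mobius n k))
    {f : EuclideanSpace ℝ (Fin n) → ComplexClifford n s}
    (hf : ∀ x (m : Fin k → ℤ),
      latticeChar l m • f (x + latticeVec n m) = f (scaleLast (latticeSgn m) x)) :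
    ∃ σ : PinorSection n k l s U, σ.IsLift f := by
  -- Equivariance holds at every point, including lattice points, so `f` descends globally.
  let F : Mobius n k → PinorBundle n k l s := Quot.lift (fun x => PinorBundle.mk x (f x)) (by
    rintro _ _ ⟨m, x, rfl, rfl⟩
    rw [PinorBundle.mk_add_latticeVec, hf])
  refine ⟨⟨fun y => F y, ?_⟩, fun x hx => rfl⟩
  rintro ⟨y, hy⟩
  induction y using Quot.ind
  rfl

end Pinor

/-! ### The Klein-Gordon operator under symmetries -/

section KleinGordon

variable {n k l : ℕ}

theorem laplacian_comp_add_right (f : EuclideanSpace ℝ (Fin n) → ℂ)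
    (v x : EuclideanSpace ℝ (Fin n)) : (Δ fun y => f (y + v)) x = (Δ f) (x + v) := by
  simp only [InnerProductSpace.laplacian_eq_iteratedFDeriv_stdOrthonormalBasis,
    iteratedFDeriv_comp_add_right]

theorem laplacian_comp_linearIsometryEquiv (f : EuclideanSpace ℝ (Fin n) → ℂ)
    (L : EuclideanSpace ℝ (Fin n) ≃ₗᵢ[ℝ] EuclideanSpace ℝ (Fin n))
    (x : EuclideanSpace ℝ (Fin n)) : (Δ fun y => f (L y)) x = (Δ f) (L x) := by
  rw [InnerProductSpace.laplacian_eq_iteratedFDeriv_orthonormalBasis _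
      (EuclideanSpace.basisFun (Fin n) ℝ),
    InnerProductSpace.laplacian_eq_iteratedFDeriv_orthonormalBasis f
      ((EuclideanSpace.basisFun (Fin n) ℝ).map L)]
  refine Finset.sum_congr rfl fun i _ => ?_
  have h := L.toContinuousLinearEquiv.iteratedFDerivWithin_comp_right f uniqueDiffOn_univ
    (x := x) (mem_univ _) 2
  simp only [preimage_univ, iteratedFDerivWithin_univ] at h
  have h' : iteratedFDeriv ℝ 2 (fun y => f (L y)) x =
    (iteratedFDeriv ℝ 2 f (L x)).compContinuousLinearMap
      fun _ => (L.toContinuousLinearEquiv : EuclideanSpace ℝ (Fin n) →L[ℝ] _) := h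
  rw [h', ContinuousMultilinearMap.compContinuousLinearMap_apply]
  congr 1
  ext j
  fin_cases j <;> rfl

theorem kleinGordon_const_mul {α : ℝ} {f : EuclideanSpace ℝ (Fin n) → ℂ}
    {x : EuclideanSpace ℝ (Fin n)} (hf : ContDiffAt ℝ 2 f x) (a : ℂ) :
    kleinGordon α (fun y => a * f y) x = a * kleinGordon α f x := by
  have h : (Δ fun y => a * f y) x = a * (Δ f) x :=
    hf.laplacian_CLM_comp_left (l := ContinuousLinearMap.mul ℝ ℂ a)
  rw [kleinGordon, kleinGordon, h]
  ring

theorem kleinGordon_congr {α : ℝ} {f g : EuclideanSpace ℝ (Fin n) → ℂ}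
    {x : EuclideanSpace ℝ (Fin n)} (h : f =ᶠ[nhds x] g) :
    kleinGordon α f x = kleinGordon α g x := by
  rw [kleinGordon, kleinGordon, h.eq_of_nhds,
    (InnerProductSpace.laplacian_congr_nhds h).eq_of_nhds]

theorem kleinGordon_add_latticeVec {α : ℝ} {g : EuclideanSpace ℝ (Fin n) → ℂ}
    (hg : ContDiff ℝ 2 g) {m : Fin k → ℤ}
    (h : ∀ x, g (x + latticeVec n m) = latticeChar l m * g (scaleLast (latticeSgn m) x))
    (x : EuclideanSpace ℝ (Fin n)) :
    kleinGordon α g (x + latticeVec n m) =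
      latticeChar l m * kleinGordon α g (scaleLast (latticeSgn m) x) := by
  set L := scaleLastIsometry n (latticeSgn_mul_self m)
  have h1 : kleinGordon α g (x + latticeVec n m) =
      kleinGordon α (fun y => g (y + latticeVec n m)) x := by
    rw [kleinGordon, kleinGordon, laplacian_comp_add_right]
  have h2 : kleinGordon α g (scaleLast (latticeSgn m) x) = kleinGordon α (fun y => g (L y)) x := by
    rw [kleinGordon, kleinGordon, laplacian_comp_linearIsometryEquiv]
    rfl
  rw [h1, h2, ← kleinGordon_const_mul (f := fun y => g (L y)) (hg.comp L.contDiff).contDiffAt,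
    funext h]
  rfl

end KleinGordon

/-! ### Test sections -/

section TestSections

variable {n k l : ℕ} {s : ℤˣ}

/-- A continuous function that is periodic with respect to `2 Λ_k` and vanishes far from the span of
the lattice is bounded. -/
theorem exists_norm_le_of_periodic (hkn : k ≤ n) {F : Type*} [NormedAddCommGroup F]
    {f : EuclideanSpace ℝ (Fin n) → F} (hf : Continuous f)
    (hper : ∀ x (m : Fin k → ℤ), f (x + latticeVec n (2 • m)) = f x)
    {C : ℝ} (hsupp : ∀ x, C < transverseSq k x → f x = 0) : ∃ B, ∀ x, ‖f x‖ ≤ B := by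
  obtain ⟨B, hB⟩ := (isCompact_closedBall (0 : EuclideanSpace ℝ (Fin n))
    (√(4 * n + C))).exists_bound_of_continuousOn hf.continuousOn
  refine ⟨max B 0, fun x => ?_⟩
  rcases lt_or_ge C (transverseSq k x) with hx | hx
  · rw [hsupp x hx, norm_zero]
    exact le_max_right _ _
  -- The translate `y` has its first `k` coordinates in `[0, 2)`.
  set m : Fin k → ℤ := fun i => -⌊x ⟨i, i.2.trans_le hkn⟩ / 2⌋ with hm
  set y := x + latticeVec n (2 • m) with hy
  rw [← hper x m, ← hy]
  refine (hB y ?_).trans (le_max_left _ _)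
  rw [mem_closedBall_zero_iff, EuclideanSpace.norm_eq]
  refine Real.sqrt_le_sqrt ?_
  have hle : ∀ i : Fin n, ‖y i‖ ^ 2 ≤ 4 + if (i : ℕ) < k then 0 else y i ^ 2 := by
    intro i
    rw [Real.norm_eq_abs, sq_abs]
    split_ifs with hi
    · have e : y i = x i - 2 * ⌊x i / 2⌋ := by
        rw [hy, PiLp.add_apply, latticeVec_apply_of_lt _ hi]
        simp [hm]
        ring
      have h1 := Int.floor_le (x i / 2)
      have h2 := Int.lt_floor_add_one (x i / 2)
      rw [e]
      nlinarith
    · linarith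
  calc ∑ i, ‖y i‖ ^ 2 ≤ ∑ i : Fin n, (4 + if (i : ℕ) < k then 0 else y i ^ 2) :=
        Finset.sum_le_sum fun i _ => hle i
    _ = 4 * n + transverseSq k y := by
        rw [Finset.sum_add_distrib]; simp [transverseSq, mul_comm]
    _ ≤ 4 * n + C := by rw [hy, transverseSq_add_latticeVec]; linarith

theorem fderiv_add_latticeVec {F : Type*} [NormedAddCommGroup F] [NormedSpace ℝ F]
    {f : EuclideanSpace ℝ (Fin n) → F} {m : Fin k → ℤ}
    (hper : ∀ x, f (x + latticeVec n m) = f x) (x : EuclideanSpace ℝ (Fin n)) :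
    fderiv ℝ f (x + latticeVec n m) = fderiv ℝ f x := by
  rw [← fderiv_comp_add_right, funext hper]

theorem fderiv_eq_zero_of_lt_transverseSq {F : Type*} [NormedAddCommGroup F] [NormedSpace ℝ F]
    {f : EuclideanSpace ℝ (Fin n) → F} {C : ℝ} (hsupp : ∀ x, C < transverseSq k x → f x = 0)
    (x : EuclideanSpace ℝ (Fin n)) (hx : C < transverseSq k x) : fderiv ℝ f x = 0 := by
  have h : f =ᶠ[𝓝 x] fun _ => 0 :=
    ((isOpen_lt continuous_const continuous_transverseSq).eventually_mem hx).mono hsupp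
  rw [h.fderiv_eq, fderiv_fun_const]
  rfl

theorem IsTestLift.boundedC2 (hkn : k < n) {g : EuclideanSpace ℝ (Fin n) → ComplexClifford n s}
    (hg : IsTestLift k l g) (c : Module.Dual ℂ (ComplexClifford n s)) :
    BoundedC2 fun x => c (g x) := by
  obtain ⟨⟨φ, hφ⟩, hsm, K, hK, hgK⟩ := hg
  obtain ⟨C, hC⟩ := exists_transverseSq_le hK
  have hcd : ContDiff ℝ 2 fun x => c (g x) :=
    mod_cast contDiff_infty.1 (contDiffOn_univ.1 (hsm c)) 2
  have hsupp : ∀ x, C < transverseSq k x → c (g x) = 0 := fun x hx => by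
    rw [hgK x fun h => (hC x h).not_gt hx, map_zero]
  have hper : ∀ x (m : Fin k → ℤ), c (g (x + latticeVec n (2 • m))) = c (g x) := fun x m => by
    rw [hφ.add_latticeVec hkn, latticeChar_two_smul, latticeSgn_two_smul, scaleLast_one, one_smul]
  have hd1 : ContDiff ℝ 1 (fderiv ℝ fun x => c (g x)) := hcd.fderiv_right (by norm_num)
  have hsupp1 := fderiv_eq_zero_of_lt_transverseSq hsupp
  have hper1 := fun (x : EuclideanSpace ℝ (Fin n)) (m : Fin k → ℤ) =>
    fderiv_add_latticeVec (f := fun x => c (g x)) (fun x => hper x m) x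
  exact ⟨hcd, exists_norm_le_of_periodic hkn.le hcd.continuous hper hsupp,
    exists_norm_le_of_periodic hkn.le hd1.continuous hper1 hsupp1,
    exists_norm_le_of_periodic hkn.le (hd1.continuous_fderiv (by norm_num))
      (fun x m => fderiv_add_latticeVec (fun x => hper1 x m) x)
      (fderiv_eq_zero_of_lt_transverseSq hsupp1)⟩

end TestSections

/-! ### Unfolding integrals over a period cell -/

section Unfolding

variable {n k l : ℕ}

/-- The translate `a + [0,1)^k × ℝ^{n-k}` of the period cell. -/
def shiftedCell (k : ℕ) (a : EuclideanSpace ℝ (Fin n)) : Set (EuclideanSpace ℝ (Fin n)) :=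
  {x | ∀ i : Fin n, (i : ℕ) < k → x i ∈ Ico (a i) (a i + 1)}

theorem shiftedCell_zero : shiftedCell k (0 : EuclideanSpace ℝ (Fin n)) = periodCell n k := by
  simp [shiftedCell, periodCell]

theorem measurableSet_shiftedCell (a : EuclideanSpace ℝ (Fin n)) :
    MeasurableSet (shiftedCell k a) := by
  have h : shiftedCell k a = ⋂ i : Fin n, ⋂ _ : (i : ℕ) < k, (fun x => x i) ⁻¹'
      Ico (a i) (a i + 1) := by
    ext x; simp [shiftedCell]
  rw [h]
  exact MeasurableSet.iInter fun i => MeasurableSet.iInter fun _ =>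
    (by fun_prop : Measurable fun x : EuclideanSpace ℝ (Fin n) => x i) measurableSet_Ico

theorem scaleLast_mem_shiftedCell (hkn : k < n) (ε : ℝ) (a x : EuclideanSpace ℝ (Fin n)) :
    scaleLast ε x ∈ shiftedCell k a ↔ x ∈ shiftedCell k a :=
  forall_congr' fun i => forall_congr' fun hi => by rw [scaleLast_apply_of_lt hkn ε x hi]

/-- The lattice translates of a cell tile `ℝⁿ`. -/
theorem existsUnique_sub_latticeVec_mem (hkn : k < n) (a x : EuclideanSpace ℝ (Fin n)) :
    ∃! m : Fin k → ℤ, x - latticeVec n m ∈ shiftedCell k a := by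
  have key : ∀ m : Fin k → ℤ, x - latticeVec n m ∈ shiftedCell k a ↔
      ∀ i : Fin k, ⌊x ⟨i, i.2.trans hkn⟩ - a ⟨i, i.2.trans hkn⟩⌋ = m i := by
    intro m
    constructor
    · intro h i
      have hi : ((⟨i, i.2.trans hkn⟩ : Fin n) : ℕ) < k := i.2
      have := h ⟨i, i.2.trans hkn⟩ hi
      rw [PiLp.sub_apply, latticeVec_apply_of_lt m hi, mem_Ico] at this
      rw [Int.floor_eq_iff]
      constructor <;> linarith [this.1, this.2]
    · intro h i hi
      have := Int.floor_eq_iff.1 (h ⟨i, hi⟩)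
      rw [PiLp.sub_apply, latticeVec_apply_of_lt m hi, mem_Ico]
      constructor <;> linarith [this.1, this.2]
  exact ⟨fun i => ⌊x ⟨i, i.2.trans hkn⟩ - a ⟨i, i.2.trans hkn⟩⌋, (key _).2 fun _ => rfl,
    fun m hm => funext fun i => ((key m).1 hm i).symm⟩

theorem hasSum_integral_shiftedCell (hkn : k < n) (a : EuclideanSpace ℝ (Fin n)) {F : Type*}
    [NormedAddCommGroup F] [NormedSpace ℝ F] {f : EuclideanSpace ℝ (Fin n) → F}
    (hf : Integrable f) :
    HasSum (fun m : Fin k → ℤ => ∫ x in shiftedCell k a, f (x + latticeVec n m)) (∫ x, f x) := by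
  set T : (Fin k → ℤ) → Set (EuclideanSpace ℝ (Fin n)) := fun m =>
    (fun x => x - latticeVec n m) ⁻¹' shiftedCell k a with hT
  have hmeas : ∀ m, MeasurableSet (T m) := fun m =>
    (measurableSet_shiftedCell a).preimage (measurable_id.sub_const _)
  have hdisj : Pairwise fun m m' => Disjoint (T m) (T m') := fun m m' hmm =>
    disjoint_left.2 fun x hx hx' =>
      hmm ((existsUnique_sub_latticeVec_mem hkn a x).unique hx hx')
  have hunion : ⋃ m, T m = univ := eq_univ_of_forall fun x =>
    mem_iUnion.2 (existsUnique_sub_latticeVec_mem hkn a x).exists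
  have key := hasSum_integral_iUnion hmeas hdisj (μ := volume) (f := f) hf.integrableOn
  rw [hunion, setIntegral_univ] at key
  convert key using 2 with m
  have hmp : MeasurePreserving (fun x : EuclideanSpace ℝ (Fin n) => x - latticeVec n m) :=
    measurePreserving_sub_right volume (latticeVec n m)
  have he : MeasurableEmbedding (fun x : EuclideanSpace ℝ (Fin n) => x - latticeVec n m) :=
    (MeasurableEquiv.subRight (latticeVec n m)).measurableEmbedding
  rw [← hmp.setIntegral_preimage_emb he (fun x => f (x + latticeVec n m))]
  simp only [sub_add_cancel, hT]

theorem measurePreserving_scaleLast {ε : ℝ} (hε : ε * ε = 1) :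
    MeasurePreserving (scaleLast ε : EuclideanSpace ℝ (Fin n) → _) :=
  (scaleLastIsometry n hε).measurePreserving

theorem measurableEmbedding_scaleLast {ε : ℝ} (hε : ε * ε = 1) :
    MeasurableEmbedding (scaleLast ε : EuclideanSpace ℝ (Fin n) → _) :=
  (scaleLastIsometry n hε).toHomeomorph.measurableEmbedding

theorem setIntegral_shiftedCell_comp_scaleLast (hkn : k < n) {ε : ℝ} (hε : ε * ε = 1)
    (a : EuclideanSpace ℝ (Fin n)) {F : Type*} [NormedAddCommGroup F] [NormedSpace ℝ F]
    (f : EuclideanSpace ℝ (Fin n) → F) :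
    ∫ x in shiftedCell k a, f (scaleLast ε x) = ∫ x in shiftedCell k a, f x := by
  rw [← (measurePreserving_scaleLast hε).setIntegral_preimage_emb
    (measurableEmbedding_scaleLast hε) f (shiftedCell k a)]
  congr 2
  ext x
  exact (scaleLast_mem_shiftedCell hkn ε a x).symm

/-- A pointwise convergent series with summable `L¹` norms is integrable. -/
theorem integrable_tsum_of_summable_integral_norm {X ι : Type*} [MeasurableSpace X] [Countable ι]
    {μ : Measure X} {f : ι → X → ℂ} (hf : ∀ i, Integrable (f i) μ)
    (hsum : Summable fun i => ∫ x, ‖f i x‖ ∂μ)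
    (hmeas : AEStronglyMeasurable (fun x => ∑' i, f i x) μ) :
    Integrable (fun x => ∑' i, f i x) μ := by
  refine ⟨hmeas, ?_⟩
  have h1 : ∫⁻ x, ‖∑' i, f i x‖ₑ ∂μ ≤ ∑' i, ∫⁻ x, ‖f i x‖ₑ ∂μ := by
    rw [← lintegral_tsum fun i => (hf i).1.enorm]
    exact lintegral_mono fun x => enorm_tsum_le_tsum_enorm
  have h2 : ∀ i, ∫⁻ x, ‖f i x‖ₑ ∂μ = ENNReal.ofReal (∫ x, ‖f i x‖ ∂μ) := fun i =>
    (ofReal_integral_norm_eq_lintegral_enorm (hf i)).symm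
  refine h1.trans_lt ?_
  simp only [h2]
  exact hsum.tsum_ofReal_lt_top

end Unfolding

/-! ### The series -/

section Series

variable {n k l : ℕ} {α : ℝ}

/-- The function that agrees with `E_α` on `ℝⁿ \ {0}`, written as minus the Laplace transform of the
heat kernel. -/
noncomputable def kgRadial (n : ℕ) (α : ℝ) (x : EuclideanSpace ℝ (Fin n)) : ℂ :=
  -((4 * Real.pi) ^ (-((n : ℝ) / 2)) : ℝ) * besselRadial n (n / 2) (α ^ 2) x

theorem rapidSmooth_kgRadial (n N : ℕ) (hα : 0 < α) : RapidSmooth N (kgRadial n α) :=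
  (rapidSmooth_besselRadial n N (by positivity) (by positivity)).const_mul _

theorem laplacian_kgRadial (hn : 0 < n) (hα : 0 < α) {x : EuclideanSpace ℝ (Fin n)} (hx : x ≠ 0) :
    (Δ (kgRadial n α)) x = α ^ 2 * kgRadial n α x := by
  have h := (rapidSmooth_besselRadial n 2 (a := n / 2) (c := α ^ 2) (by positivity)
    (by positivity)).laplacian_const_mul (-((4 * Real.pi) ^ (-((n : ℝ) / 2)) : ℝ)) hx
  rw [laplacian_besselRadial hn (by positivity) hx] at h
  refine h.trans ?_
  rw [kgRadial]
  push_cast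
  ring

theorem euclideanKG_scaleLast (m : Fin k → ℤ) (x : EuclideanSpace ℝ (Fin n)) :
    euclideanKG n α (scaleLast (latticeSgn m) x) = euclideanKG n α x := by
  simp only [euclideanKG, norm_scaleLast (latticeSgn_mul_self m)]

theorem mobiusTerm_eq (m : Fin k → ℤ) (x : EuclideanSpace ℝ (Fin n)) :
    mobiusTerm n l α m x = latticeChar l m * euclideanKG n α (x + latticeVec n m) := by
  rw [mobiusTerm, euclideanKG_scaleLast]

theorem mobiusTerm_eq_kgRadial (hn : 0 < n) (hα : 0 < α) {x : EuclideanSpace ℝ (Fin n)}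
    (hx : x ∉ latticeSet n k) (m : Fin k → ℤ) :
    mobiusTerm n l α m x = latticeChar l m * kgRadial n α (x + latticeVec n m) := by
  rw [mobiusTerm_eq, euclideanKG_eq hn hα (add_latticeVec_ne_zero hx m), kgRadial]

theorem mobiusSeries_eq_periodize (hn : 0 < n) (hα : 0 < α) {x : EuclideanSpace ℝ (Fin n)}
    (hx : x ∉ latticeSet n k) :
    mobiusSeries n k l α x = periodize (latticeChar (k := k) l) (kgRadial n α) x :=
  tsum_congr fun m => mobiusTerm_eq_kgRadial hn hα hx m

theorem hasSumUniformlyOn_mobiusTerm (hkn : k < n) (hα : 0 < α)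
    {K : Set (EuclideanSpace ℝ (Fin n))} (hK : IsCompact K) (hKL : K ⊆ (latticeSet n k)ᶜ) :
    HasSumUniformlyOn (fun m : Fin k → ℤ => mobiusTerm n l α m) (mobiusSeries n k l α) K := by
  obtain ⟨v, hv, h⟩ := (rapidSmooth_kgRadial n 0 hα).rapidDecay.exists_summable_bound_twisted hkn.le
    (fun m => (norm_latticeChar (l := l) m).le) hK hKL
  refine HasSumUniformlyOn.of_norm_le_summable hv fun m x hx => ?_
  rw [mobiusTerm_eq_kgRadial (by omega) hα (hKL hx)]
  exact h m x hx

/-- The equivariance of a lift. No convergence is needed: a divergent series has value `0` on both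
sides. -/
theorem mobiusSeries_add_latticeVec (hkn : k < n) (x : EuclideanSpace ℝ (Fin n))
    (m : Fin k → ℤ) : latticeChar l m * mobiusSeries n k l α (x + latticeVec n m) =
      mobiusSeries n k l α (scaleLast (latticeSgn m) x) := by
  simp only [mobiusSeries, mobiusTerm_eq]
  rw [← tsum_mul_left, ← (Equiv.addLeft m).tsum_eq fun m' =>
    latticeChar l m' * euclideanKG n α (scaleLast (latticeSgn m) x + latticeVec n m')]
  refine tsum_congr fun m' => ?_
  rw [Equiv.coe_addLeft, ← scaleLast_add_latticeVec hkn, euclideanKG_scaleLast, latticeVec_add,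
    latticeChar_add, mul_assoc, add_assoc]

theorem contDiffOn_mobiusSeries (hkn : k < n) (hα : 0 < α) :
    ContDiffOn ℝ ∞ (mobiusSeries n k l α) (latticeSet n k)ᶜ := by
  have h : ContDiffOn ℝ ∞ (periodize (latticeChar (k := k) l) (kgRadial n α))
      (latticeSet n k)ᶜ := contDiffOn_infty.2 fun N =>
    contDiffOn_periodize hkn.le (fun m => (norm_latticeChar (l := l) m).le) N
      (rapidSmooth_kgRadial n (N + 1) hα)
  exact h.congr fun x hx => mobiusSeries_eq_periodize (by omega) hα hx

theorem kleinGordon_mobiusSeries (hkn : k < n) (hα : 0 < α) {x : EuclideanSpace ℝ (Fin n)}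
    (hx : x ∉ latticeSet n k) : kleinGordon α (mobiusSeries n k l α) x = 0 := by
  have hn : 0 < n := by omega
  have h : mobiusSeries n k l α =ᶠ[𝓝 x] periodize (latticeChar (k := k) l) (kgRadial n α) :=
    ((isClosed_latticeSet hkn.le).isOpen_compl.eventually_mem hx).mono fun y hy =>
      mobiusSeries_eq_periodize hn hα hy
  rw [kleinGordon_congr h, kleinGordon, laplacian_periodize hkn.le
    (fun m => (norm_latticeChar (l := l) m).le) (rapidSmooth_kgRadial n 2 hα) hx, periodize,
    periodize, ← tsum_mul_left, sub_eq_zero]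
  refine tsum_congr fun m => ?_
  rw [laplacian_kgRadial hn hα (add_latticeVec_ne_zero hx m)]
  ring

theorem integrable_euclideanKG_add (hn : 0 < n) (hα : 0 < α) (v : EuclideanSpace ℝ (Fin n)) :
    Integrable fun x => euclideanKG n α (x + v) :=
  (integrable_euclideanKG hn hα).comp_add_right v

/-- The series is integrable over a period cell although it is singular at the lattice points: the
`L¹` norms of the terms add up to the `L¹` norm of `E_α`. -/
theorem integrableOn_mobiusSeries (hkn : k < n) (hα : 0 < α) (a : EuclideanSpace ℝ (Fin n)) :
    IntegrableOn (mobiusSeries n k l α) (shiftedCell k a) := by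
  have hn : 0 < n := by omega
  have : Nonempty (Fin n) := ⟨⟨0, hn⟩⟩
  have hnull : ∀ᵐ x : EuclideanSpace ℝ (Fin n), x ∈ (latticeSet n k)ᶜ :=
    compl_mem_ae_iff.2 ((countable_range _).measure_zero _)
  have hmeas : AEStronglyMeasurable (mobiusSeries n k l α) := by
    have h := (contDiffOn_mobiusSeries (l := l) hkn hα).continuousOn.aestronglyMeasurable
      (μ := volume) (isClosed_latticeSet hkn.le).measurableSet.compl
    rwa [Measure.restrict_eq_self_of_ae_mem hnull] at h
  refine integrable_tsum_of_summable_integral_norm (fun m => ?_) ?_ hmeas.restrict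
  · rw [funext (mobiusTerm_eq m)]
    exact ((integrable_euclideanKG_add hn hα _).const_mul _).integrableOn
  · have h := (hasSum_integral_shiftedCell hkn a (integrable_euclideanKG hn hα).norm).summable
    refine h.congr fun m => ?_
    simp only [mobiusTerm_eq, norm_mul, norm_latticeChar, one_mul]

theorem shiftedCell_mem_nhds (x : EuclideanSpace ℝ (Fin n)) :
    shiftedCell k (WithLp.toLp 2 fun i => x i - 1 / 2) ∈ 𝓝 x := by
  have h : ∀ᶠ y in 𝓝 x, ∀ i : Fin n, y i ∈ Ioo (x i - 1 / 2) (x i - 1 / 2 + 1) := by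
    refine eventually_all.2 fun i => ?_
    have hc : Continuous fun y : EuclideanSpace ℝ (Fin n) => y i := by fun_prop
    exact hc.continuousAt.eventually_mem (Ioo_mem_nhds (by linarith) (by linarith))
  exact h.mono fun y hy i _ => Ioo_subset_Ico_self (hy i)

theorem locallyIntegrable_mobiusSeries (hkn : k < n) (hα : 0 < α) :
    LocallyIntegrable (mobiusSeries n k l α) := fun x =>
  ⟨_, shiftedCell_mem_nhds x, integrableOn_mobiusSeries hkn hα _⟩

/-- The unfolding identity: the integral over a period cell of the series against a function with
the equivariance of a lift is the integral of `E_α` against this function over `ℝⁿ`. -/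
theorem setIntegral_mobiusSeries_mul (hkn : k < n) (hα : 0 < α)
    {ψ : EuclideanSpace ℝ (Fin n) → ℂ} (hψ : Continuous ψ) {B : ℝ} (hB : ∀ x, ‖ψ x‖ ≤ B)
    (heq : ∀ x (m : Fin k → ℤ),
      ψ (x + latticeVec n m) = latticeChar l m * ψ (scaleLast (latticeSgn m) x)) :
    IntegrableOn (fun x => mobiusSeries n k l α x * ψ x) (periodCell n k) ∧
    ∫ x in periodCell n k, mobiusSeries n k l α x * ψ x = ∫ x, euclideanKG n α x * ψ x := by
  have hn : 0 < n := by omega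
  rw [← shiftedCell_zero]
  have hW : Integrable fun x => euclideanKG n α x * ψ x :=
    (integrable_euclideanKG hn hα).mul_bdd hψ.aestronglyMeasurable (Eventually.of_forall hB)
  refine ⟨(integrableOn_mobiusSeries hkn hα 0).mul_bdd hψ.aestronglyMeasurable
    (Eventually.of_forall hB), ?_⟩
  -- Each term is the product `E_α ψ` at the point `(x̲, ±x_n) + v̲`.
  have hterm : ∀ (m : Fin k → ℤ) (x : EuclideanSpace ℝ (Fin n)), mobiusTerm n l α m x * ψ x =
      euclideanKG n α (scaleLast (latticeSgn m) x + latticeVec n m) *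
        ψ (scaleLast (latticeSgn m) x + latticeVec n m) := fun m x => by
    rw [heq, scaleLast_scaleLast, latticeSgn_mul_self, scaleLast_one,
      ← scaleLast_add_latticeVec hkn, mobiusTerm]
    ring
  have hfold : ∀ m : Fin k → ℤ, ∫ x in shiftedCell k 0, mobiusTerm n l α m x * ψ x =
      ∫ x in shiftedCell k 0, euclideanKG n α (x + latticeVec n m) * ψ (x + latticeVec n m) :=
    fun m => by
      simp only [hterm]
      exact setIntegral_shiftedCell_comp_scaleLast hkn (latticeSgn_mul_self m) 0
        (fun x => euclideanKG n α (x + latticeVec n m) * ψ (x + latticeVec n m))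
  have hfold' : ∀ m : Fin k → ℤ, ∫ x in shiftedCell k 0, ‖mobiusTerm n l α m x * ψ x‖ =
      ∫ x in shiftedCell k 0, ‖euclideanKG n α (x + latticeVec n m) * ψ (x + latticeVec n m)‖ :=
    fun m => by
      simp only [hterm]
      exact setIntegral_shiftedCell_comp_scaleLast hkn (latticeSgn_mul_self m) 0
        (fun x => ‖euclideanKG n α (x + latticeVec n m) * ψ (x + latticeVec n m)‖)
  have hint : ∀ m : Fin k → ℤ,
      IntegrableOn (fun x => mobiusTerm n l α m x * ψ x) (shiftedCell k 0) := fun m => by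
    simp only [mobiusTerm_eq]
    exact (((integrable_euclideanKG_add hn hα _).const_mul _).mul_bdd hψ.aestronglyMeasurable
      (Eventually.of_forall hB)).integrableOn
  have h1 := hasSum_integral_of_summable_integral_norm hint (by
    simp only [hfold']
    exact (hasSum_integral_shiftedCell hkn 0 hW.norm).summable)
  have h2 := hasSum_integral_shiftedCell (k := k) hkn 0 hW
  simp only [hfold, tsum_mul_right] at h1
  exact h1.unique h2

end Series

theorem mainTheorem2 (n k l : ℕ) (hk : 1 ≤ k) (hkn : k < n) (hl : l ≤ k) (s : ℤˣ)
    (α : ℝ) (hα : 0 < α) :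
    (∀ K : Set (EuclideanSpace ℝ (Fin n)), IsCompact K → K ⊆ (latticeSet n k)ᶜ →
      HasSumUniformlyOn (fun m : Fin k → ℤ => mobiusTerm n l α m) (mobiusSeries n k l α) K) ∧
    ∃ σ : PinorSection n k l s {mobiusOrigin n k}ᶜ,
      σ.IsLift (fun x => algebraMap ℂ (ComplexClifford n s) (mobiusSeries n k l α x)) ∧
      IsKGFundamentalSolution α σ := by
  refine ⟨fun K hK hKL => hasSumUniformlyOn_mobiusTerm hkn hα hK hKL, ?_⟩
  obtain ⟨σ, hσ⟩ := exists_pinorSection_isLift (l := l) (s := s) {mobiusOrigin n k}ᶜ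
    (f := fun x => algebraMap ℂ (ComplexClifford n s) (mobiusSeries n k l α x))
    fun x m => by
      refine (Algebra.smul_def (A := ComplexClifford n s) (latticeChar l m) _).trans ?_
      rw [← map_mul, mobiusSeries_add_latticeVec hkn]
  have hc : ∀ (c : Module.Dual ℂ (ComplexClifford n s)) (z : ℂ) (X : ComplexClifford n s),
      c (algebraMap ℂ (ComplexClifford n s) z * X) = z * c X := fun c z X => by
    rw [← Algebra.smul_def, map_smul, smul_eq_mul]
  have hc1 : ∀ (c : Module.Dual ℂ (ComplexClifford n s)) (z : ℂ),
      c (algebraMap ℂ (ComplexClifford n s) z) = c 1 * z := fun c z => by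
    rw [← mul_one (algebraMap ℂ (ComplexClifford n s) z), hc, mul_comm]
  refine ⟨σ, hσ, _, hσ, fun c => ?_, fun c x hx => ?_, fun c => ?_, fun g h hg hgh c => ?_⟩
  · simp only [hc1]
    exact contDiffOn_const.mul
      ((contDiffOn_mobiusSeries hkn hα).mono preimage_compl_origin_subset)
  · have hx' := preimage_compl_origin_subset hx
    have hcd : ContDiffAt ℝ 2 (mobiusSeries n k l α) x :=
      mod_cast contDiffAt_infty.1 ((contDiffOn_mobiusSeries hkn hα).contDiffAt
        ((isClosed_latticeSet hkn.le).isOpen_compl.mem_nhds hx')) 2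
    simp only [hc1, Pi.zero_apply, map_zero]
    rw [kleinGordon_const_mul hcd, kleinGordon_mobiusSeries hkn hα hx', mul_zero]
  · simp only [hc1]
    exact (locallyIntegrable_mobiusSeries hkn hα).smul (c 1)
  · have hgb := hg.boundedC2 hkn c
    obtain ⟨B, hB⟩ := hgb.bound
    obtain ⟨D, hD⟩ := hgb.bound_laplacian
    have hch : (fun x => c (h x)) = kleinGordon α fun x => c (g x) :=
      funext fun x => (hgh c x trivial).symm
    obtain ⟨⟨φ, hφ⟩, -⟩ := id hg
    have hequiv : ∀ x (m : Fin k → ℤ), c (h (x + latticeVec n m)) =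
        latticeChar l m * c (h (scaleLast (latticeSgn m) x)) := fun x m => by
      have := kleinGordon_add_latticeVec (α := α) (l := l) (m := m) hgb.contDiff
        (fun x => by rw [hφ.add_latticeVec hkn, map_smul, smul_eq_mul]) x
      rwa [← hch] at this
    have hcont : Continuous fun x => c (h x) := by
      rw [hch]
      exact hgb.continuous_laplacian.sub (continuous_const.mul hgb.contDiff.continuous)
    have hbound : ∀ x, ‖c (h x)‖ ≤ D + α ^ 2 * B := fun x => by
      rw [show c (h x) = _ from congrFun hch x, kleinGordon]
      refine (norm_sub_le _ _).trans (add_le_add (hD x) ?_)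
      rw [norm_mul, norm_pow, Complex.norm_real, Real.norm_eq_abs, sq_abs]
      exact mul_le_mul_of_nonneg_left (hB x) (sq_nonneg α)
    have key := setIntegral_mobiusSeries_mul hkn hα hcont hbound hequiv
    simp only [hc]
    have hfund := integral_euclideanKG_mul_kleinGordon (by omega) hα hgb
    rw [← hch] at hfund
    exact ⟨key.1, key.2.trans hfund⟩
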